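/- Let $\mathbb{T}=\mathbb{R}/\mathbb{Z}$, identified with $[0,1)$ (addition mod $1$), with normalized Lebesgue (Haar) measure $\mu$, let $\lambda$ be Lebesgue measure on $\mathbb{R}$, and let $\varphi(x)=-1-\log(1-x)$ for $x\in[0,1)$. Then for $\mu$-almost every $\alpha\in\mathbb{T}$ the cylindrical transformation $$S_{\alpha,\varphi}:\mathbb{T}\times\mathbb{R}\to\mathbb{T}\times\mathbb{R},\qquad S_{\alpha,\varphi}(x,y)=(x+\alpha,\,-1-\log(1-x)+y)$$ is ergodic with respect to the infinite measure $\mu\otimes\lambda$; that is, it preserves $\mu\otimes\lambda$, and every measurable set $A\subseteq\mathbb{T}\times\mathbb{R}$ with $S_{\alpha,\varphi}^{-1}A=A$ satisfies $(\mu\otimes\lambda)(A)=0$ or $(\mu\otimes\lambda)(A^{c})=0$. -/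

import Mathlib

/-- The representative in `[0, 1)` of a point of the circle `𝕋 = ℝ / ℤ`. -/
noncomputable def circleRep (x : UnitAddCircle) : ℝ :=
  (AddCircle.equivIco (1 : ℝ) 0 x : ℝ)

/-- The function `φ(x) = -1 - log (1 - x)`, `x ∈ [0, 1)`, regarded as a function on the circle
`𝕋 = ℝ / ℤ` identified with `[0, 1)`. -/
noncomputable def logCocycle (x : UnitAddCircle) : ℝ :=
  -1 - Real.log (1 - circleRep x)

/-- The cylindrical transformation `S_{α,φ} (x, y) = (x + α, φ(x) + y)` of `𝕋 × ℝ`. -/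
def cylindricalTransformation (α : UnitAddCircle) (φ : UnitAddCircle → ℝ) :
    UnitAddCircle × ℝ → UnitAddCircle × ℝ :=
  fun p => (p.1 + α, φ p.1 + p.2)

open MeasureTheory Filter Topology
open Set (Icc Ico Ioc Ioo)
open Finset (range sum_congr sum_le_sum sum_sub_distrib sum_add_distrib sum_range_succ sum_div)

/-! The proof shows that every real `r` is an essential value of the cocycle, uniformly enough to
force triviality of invariant sets. Let `α = p/q + θ/q²` with `p` coprime to `q` and `|θ| ≤ 0.48`.
The first `q` orbit points fall one into each cell of a grid of mesh `1/q`, and they stay away from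
the cell boundaries when the starting point lies in the middle part of its cell. As the starting
point crosses that middle part, the Birkhoff sum of length `q` increases from about `-H/100` to
about `H/100`, where `H` is the `q`-th harmonic number, with total slope at most `100 * H`. Hence in
every cell it stays within `ε` of `r` on a window of relative length `ε / (100 * H)`. The union of
these windows is the comb of `q`.

The mass of a single comb tends to zero, so no single `q` suffices. For almost every `α`, however,
Borel–Cantelli and a weak Hurwitz inequality give such a `q` on every late scale of a sparse
sequence along which `1 / H` is of order at least `1 / (k log k)`, a divergent series. The scales
are far enough apart for the combs to be quasi-independent, so by a second moment bound a finite
batch of total mass at least 1 samples functions on the circle well enough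
(`CombSequence.integral_abs_sub_le`).

Let `A` be invariant, with sections `A_x`. On a comb, `A_x` is the translate of `A_{x+qα}` by nearly
`-r`, while `qα` tends to 0. Comparing the functions `|A_x ∩ I|` and `|A_x ∩ (I + r)|` shows that
they agree almost everywhere (`ae_integral_abs_sub_le`). So almost every section is translation
invariant in measure, hence null or conull, and ergodicity of the irrational rotation decides which.
-/

/-- `-1 - log (1 - {x})` as a `1`-periodic function on the real line. -/
noncomputable def periodicLog (x : ℝ) : ℝ := -1 - Real.log (1 - Int.fract x)

/-- The Birkhoff sum of `periodicLog` at an equidistributed grid with offset `v`. -/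
noncomputable def gridSum (q : ℕ) (v : ℝ) : ℝ :=
  ∑ i ∈ range q, (-1 - Real.log (((i : ℝ) + 1 - v) / q))

/-! ### Midpoint sums of the logarithm -/

theorem harmonic_cast_eq (q : ℕ) : (harmonic q : ℝ) = ∑ i ∈ range q, 1 / ((i : ℝ) + 1) := by
  simp [harmonic]

theorem log_le_half_sub_inv {y : ℝ} (hy : 1 ≤ y) : Real.log y ≤ (y - y⁻¹) / 2 := by
  rw [← Real.sinh_log (by linarith)]
  exact Real.self_le_sinh_iff.2 (Real.log_nonneg hy)

theorem half_sub_inv_le_log {y : ℝ} (hy0 : 0 < y) (hy : y ≤ 1) : (y - y⁻¹) / 2 ≤ Real.log y := by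
  have h := log_le_half_sub_inv (y := y⁻¹) ((one_le_inv₀ hy0).2 hy)
  rw [Real.log_inv, inv_inv] at h
  linarith

/-- Concavity of `log` in midpoint form: the integral of `log` over `[1 - x, 1 + x]` is the left
side minus `2 * x`, and it is at most `2 * x * log 1 = 0`. -/
theorem midpoint_log_lower {x : ℝ} (h0 : 0 < x) (h1 : x < 1) :
    (1 + x) * Real.log (1 + x) - (1 - x) * Real.log (1 - x) ≤ 2 * x := by
  have a := log_le_half_sub_inv (y := 1 + x) (by linarith)
  have b := half_sub_inv_le_log (y := 1 - x) (by linarith) (by linarith)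
  have a' := mul_le_mul_of_nonneg_left a (show 0 ≤ 1 + x by linarith)
  have b' := mul_le_mul_of_nonneg_left b (show 0 ≤ 1 - x by linarith)
  have e1 : (1 + x) * ((1 + x - (1 + x)⁻¹) / 2) = ((1 + x) ^ 2 - 1) / 2 := by
    field_simp
  have e2 : (1 - x) * ((1 - x - (1 - x)⁻¹) / 2) = ((1 - x) ^ 2 - 1) / 2 := by
    have : (1 - x) ≠ 0 := by linarith
    field_simp
  nlinarith

/-- The midpoint rule loses at most a cubic error; after rescaling by `n + 1/2` this is summable in
`n`. -/
theorem midpoint_log_upper {x : ℝ} (h0 : 0 < x) (h1 : x < 1) :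
    2 * x - x ^ 3 ≤ (1 + x) * Real.log (1 + x) - (1 - x) * Real.log (1 - x) := by
  have a : x - x ^ 2 / 2 ≤ Real.log (1 + x) := by
    refine le_trans ?_ (Real.le_log_one_add_of_nonneg h0.le)
    rw [le_div_iff₀ (by linarith)]
    nlinarith [pow_pos h0 3]
  have b : x + x ^ 2 / 2 ≤ -Real.log (1 - x) := by
    have h := Real.le_log_one_add_of_nonneg (x := x / (1 - x)) (by apply div_nonneg <;> linarith)
    have hx : (1 - x) ≠ 0 := by linarith
    have e : 1 + x / (1 - x) = (1 - x)⁻¹ := by field_simp; ring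
    rw [e, Real.log_inv] at h
    refine le_trans ?_ h
    have e2 : 2 * (x / (1 - x)) / (x / (1 - x) + 2) = 2 * x / (2 - x) := by
      have : (2 - x) ≠ 0 := by linarith
      have : x / (1 - x) + 2 = (2 - x) / (1 - x) := by field_simp; ring
      rw [this]; field_simp
    rw [e2, le_div_iff₀ (by linarith)]
    nlinarith [pow_pos h0 3]
  have a' := mul_le_mul_of_nonneg_left a (show 0 ≤ 1 + x by linarith)
  have b' := mul_le_mul_of_nonneg_left b (show 0 ≤ 1 - x by linarith)
  nlinarith

/-- Comparison of `log (n + 1/2)` with `∫ t in n..n+1, log t`. -/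
theorem midpoint_log_identity (n : ℕ) (hn : 1 ≤ n) :
    ((n : ℝ) + 1) * Real.log (n + 1) - n * Real.log n - Real.log (n + 1 / 2) =
      ((2 * n + 1 : ℝ) / 2) * ((1 + 1 / (2 * n + 1 : ℝ)) * Real.log (1 + 1 / (2 * n + 1 : ℝ))
        - (1 - 1 / (2 * n + 1 : ℝ)) * Real.log (1 - 1 / (2 * n + 1 : ℝ))) := by
  have hn' : (1 : ℝ) ≤ n := by exact_mod_cast hn
  have e1 : 1 + 1 / (2 * n + 1 : ℝ) = (n + 1) / (n + 1 / 2) := by field_simp; ring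
  have e2 : 1 - 1 / (2 * n + 1 : ℝ) = n / (n + 1 / 2) := by field_simp; ring
  rw [e1, e2, Real.log_div (by positivity) (by positivity),
    Real.log_div (by positivity) (by positivity)]
  field_simp
  ring

theorem sum_log_half_lower (q : ℕ) :
    q * Real.log q - q ≤ ∑ i ∈ range q, Real.log ((i : ℝ) + 1 / 2) := by
  induction q with
  | zero => simp
  | succ n ih =>
    rw [sum_range_succ]
    rcases Nat.eq_zero_or_pos n with rfl | hn
    · have := half_sub_inv_le_log (y := 1 / 2) (by norm_num) (by norm_num)
      norm_num at this ⊢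
      linarith
    · have h := midpoint_log_identity n hn
      have hn' : (1 : ℝ) ≤ n := by exact_mod_cast hn
      have hx0 : 0 < 1 / (2 * n + 1 : ℝ) := by positivity
      have hx1 : 1 / (2 * n + 1 : ℝ) < 1 := by
        rw [div_lt_one (by positivity)]; linarith
      have h2 := mul_le_mul_of_nonneg_left (midpoint_log_lower hx0 hx1)
        (show 0 ≤ (2 * n + 1 : ℝ) / 2 by positivity)
      rw [← h] at h2
      have h3 : (2 * n + 1 : ℝ) / 2 * (2 * (1 / (2 * n + 1 : ℝ))) = 1 := by field_simp
      push_cast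
      linarith

theorem sum_log_half_upper (q : ℕ) (hq : 1 ≤ q) :
    ∑ i ∈ range q, Real.log ((i : ℝ) + 1 / 2) ≤ q * Real.log q - q + 2 - 1 / q := by
  induction q, hq using Nat.le_induction with
  | base =>
    have := Real.log_nonpos (x := 1 / 2) (by norm_num) (by norm_num)
    norm_num at this ⊢
    linarith
  | succ n hn ih =>
    rw [sum_range_succ]
    have h := midpoint_log_identity n hn
    have hn' : (1 : ℝ) ≤ n := by exact_mod_cast hn
    have hx0 : 0 < 1 / (2 * n + 1 : ℝ) := by positivity
    have hx1 : 1 / (2 * n + 1 : ℝ) < 1 := by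
      rw [div_lt_one (by positivity)]; linarith
    have h2 := mul_le_mul_of_nonneg_left (midpoint_log_upper hx0 hx1)
      (show 0 ≤ (2 * n + 1 : ℝ) / 2 by positivity)
    rw [← h] at h2
    have h3 : (2 * n + 1 : ℝ) / 2 * (2 * (1 / (2 * n + 1 : ℝ)) - (1 / (2 * n + 1 : ℝ)) ^ 3)
        = 1 - 1 / (2 * (2 * n + 1 : ℝ) ^ 2) := by field_simp
    -- The error of one step telescopes; this is why the claim carries the correction `2 - 1 / q`.
    have h4 : 1 / (2 * (2 * n + 1 : ℝ) ^ 2) ≤ 1 / n - 1 / (n + 1) := by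
      have : (1 : ℝ) / n - 1 / (n + 1) = 1 / (n * (n + 1)) := by field_simp; ring
      rw [this]
      apply one_div_le_one_div_of_le (by positivity)
      nlinarith
    push_cast
    linarith

theorem gridSum_half (q : ℕ) (hq : 1 ≤ q) :
    gridSum q (1 / 2) = q * Real.log q - q - ∑ i ∈ range q, Real.log ((i : ℝ) + 1 / 2) := by
  have hq' : (1 : ℝ) ≤ q := by exact_mod_cast hq
  have : ∀ i ∈ range q, -1 - Real.log (((i : ℝ) + 1 - 1 / 2) / q)
      = (Real.log q - 1) - Real.log ((i : ℝ) + 1 / 2) := by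
    intro i _
    rw [Real.log_div (by have : (0 : ℝ) ≤ i := i.cast_nonneg
                         linarith) (by positivity)]
    rw [show (i : ℝ) + 1 - 1 / 2 = i + 1 / 2 by ring]
    ring
  rw [gridSum, sum_congr rfl this, sum_sub_distrib]
  simp

theorem log_sub_log_lower {x y : ℝ} (hx : 0 < x) (hxy : x ≤ y) :
    (y - x) / y ≤ Real.log y - Real.log x := by
  have hy : 0 < y := by linarith
  have h := Real.one_sub_inv_le_log_of_pos (x := y / x) (by positivity)
  rw [Real.log_div hy.ne' hx.ne'] at h
  have : 1 - (y / x)⁻¹ = (y - x) / y := by field_simp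
  linarith

theorem log_sub_log_upper {x y : ℝ} (hx : 0 < x) (hxy : x ≤ y) :
    Real.log y - Real.log x ≤ (y - x) / x := by
  have hy : 0 < y := by linarith
  have h := Real.log_le_sub_one_of_pos (x := y / x) (by positivity)
  rw [Real.log_div hy.ne' hx.ne'] at h
  have : (y / x) - 1 = (y - x) / x := by field_simp
  linarith

/-- At offset `1/2` the sum is a midpoint rule for a function of integral zero and lies in `[-2,
0]`. Moving the offset by `1/100` changes the `i`-th term by at least `1 / (100 * (i + 1))`, whence
the harmonic number. -/
theorem gridSum_low (q : ℕ) (hq : 1 ≤ q) : gridSum q (49 / 100) ≤ -(harmonic q : ℝ) / 100 := by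
  have h1 : gridSum q (1 / 2) ≤ 0 := by
    rw [gridSum_half q hq]; linarith [sum_log_half_lower q]
  have hq' : (1 : ℝ) ≤ q := by exact_mod_cast hq
  have h2 : gridSum q (49 / 100) ≤ gridSum q (1 / 2) - (harmonic q : ℝ) / 100 := by
    rw [harmonic_cast_eq, sum_div, gridSum, gridSum, ← sum_sub_distrib]
    apply sum_le_sum
    intro i _
    have hi : (0 : ℝ) ≤ i := i.cast_nonneg
    rw [Real.log_div (by linarith) (by positivity), Real.log_div (by linarith) (by positivity)]
    have := log_sub_log_lower (x := (i : ℝ) + 1 - 1 / 2) (y := (i : ℝ) + 1 - 49 / 100)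
      (by linarith) (by linarith)
    have h3 : 1 / ((i : ℝ) + 1) / 100 ≤
        ((i : ℝ) + 1 - 49 / 100 - (i + 1 - 1 / 2)) / (i + 1 - 49 / 100) := by
      rw [div_div, div_le_div_iff₀ (by positivity) (by linarith)]
      nlinarith
    linarith
  linarith

theorem gridSum_high (q : ℕ) (hq : 1 ≤ q) :
    (harmonic q : ℝ) / 100 - 2 ≤ gridSum q (51 / 100) := by
  have hq' : (1 : ℝ) ≤ q := by exact_mod_cast hq
  have h1 : -2 ≤ gridSum q (1 / 2) := by
    rw [gridSum_half q hq]
    have : 0 ≤ 1 / (q : ℝ) := by positivity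
    linarith [sum_log_half_upper q hq]
  have h2 : gridSum q (1 / 2) + (harmonic q : ℝ) / 100 ≤ gridSum q (51 / 100) := by
    rw [harmonic_cast_eq, sum_div, gridSum, gridSum, ← sum_add_distrib]
    apply sum_le_sum
    intro i _
    have hi : (0 : ℝ) ≤ i := i.cast_nonneg
    rw [Real.log_div (by linarith) (by positivity), Real.log_div (by linarith) (by positivity)]
    have := log_sub_log_lower (x := (i : ℝ) + 1 - 51 / 100) (y := (i : ℝ) + 1 - 1 / 2)
      (by linarith) (by linarith)
    have h3 : 1 / ((i : ℝ) + 1) / 100 ≤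
        ((i : ℝ) + 1 - 1 / 2 - (i + 1 - 51 / 100)) / (i + 1 - 1 / 2) := by
      rw [div_div, div_le_div_iff₀ (by positivity) (by linarith)]
      nlinarith
    linarith
  linarith

/-! ### Birkhoff sums along one rational approximation -/

/-- Coprimality makes `m + j * p` run through all residues. The order is reversed because the
singularity sits at the right end of `[0, 1)`: `σ j` counts the full cells between the cell of the
`j`-th point and 1. -/
theorem exists_residue_perm (q : ℕ) (hq : 1 ≤ q) (p m : ℤ) (hp : IsCoprime p (q : ℤ)) :
    ∃ σ : ℕ → ℕ, (∀ h : ℕ → ℝ, ∑ j ∈ range q, h (σ j) = ∑ i ∈ range q, h i) ∧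
      ∀ j : ℕ, (σ j : ℤ) = q - 1 - (m + j * p) % q := by
  have hq0 : (0 : ℤ) < q := by exact_mod_cast hq
  have hb : ∀ j : ℕ, ((q - 1 - (m + j * p) % q).toNat : ℤ) = q - 1 - (m + j * p) % q := by
    intro j
    have := Int.emod_lt_of_pos (m + j * p) hq0
    exact Int.toNat_of_nonneg (by linarith)
  refine ⟨fun j => (q - 1 - (m + j * p) % q).toNat, ?_, hb⟩
  have inj : Set.InjOn (fun j : ℕ => ((q : ℤ) - 1 - (m + j * p) % q).toNat) (range q) := by
    intro j hj k hk h
    have h' : ((q : ℤ) - 1 - (m + j * p) % q) = (q - 1 - (m + k * p) % q) := by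
      rw [← hb j, ← hb k]; exact congrArg _ h
    have h2 : (m + j * p) % q = (m + k * p) % q := by linarith
    have h3 : (q : ℤ) ∣ ((j : ℤ) - k) * p := by
      have h4 := Int.ModEq.dvd (show (m + k * p) ≡ (m + j * p) [ZMOD q] from h2.symm)
      rwa [show m + j * p - (m + k * p) = ((j : ℤ) - k) * p by ring] at h4
    have h5 : (q : ℤ) ∣ (j : ℤ) - k := hp.symm.dvd_of_dvd_mul_right h3
    simp only [Finset.coe_range, Set.mem_Iio] at hj hk
    have h6 : (j : ℤ) - k = 0 := by
      apply Int.eq_zero_of_abs_lt_dvd h5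
      rw [abs_lt]; constructor <;> omega
    omega
  intro h
  have himg : (range q).image (fun j : ℕ => ((q : ℤ) - 1 - (m + j * p) % q).toNat) = range q := by
    apply Finset.eq_of_subset_of_card_le
    · intro i hi
      obtain ⟨j, -, rfl⟩ := Finset.mem_image.1 hi
      have := Int.emod_nonneg (m + j * p) hq0.ne'
      have := hb j
      rw [Finset.mem_range]
      omega
    · rw [Finset.card_image_of_injOn inj]
  conv_rhs => rw [← himg]
  rw [Finset.sum_image inj]

theorem periodicLog_grid {q : ℕ} (hq : 1 ≤ q) (n : ℤ) {v : ℝ} (h0 : 0 ≤ v) (h1 : v < 1) :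
    periodicLog ((n + v) / q) = -1 - Real.log ((((q : ℤ) - 1 - n % q : ℤ) + 1 - v) / q) := by
  have hq0 : (0 : ℤ) < q := by exact_mod_cast hq
  have hq' : (0 : ℝ) < q := by exact_mod_cast hq
  have e : ((n : ℝ) + v) / q = ((n / (q : ℤ) : ℤ) : ℝ) + (((n % (q : ℤ) : ℤ) : ℝ) + v) / q := by
    have : (n : ℝ) = (q : ℝ) * ((n / (q : ℤ) : ℤ) : ℝ) + ((n % (q : ℤ) : ℤ) : ℝ) := by
      exact_mod_cast (Int.mul_ediv_add_emod n q).symm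
    rw [this]
    field_simp
    ring
  have hr0 : (0 : ℝ) ≤ ((n % (q : ℤ) : ℤ) : ℝ) := by exact_mod_cast Int.emod_nonneg n hq0.ne'
  have hr1 : ((n % (q : ℤ) : ℤ) : ℝ) + 1 ≤ q := by exact_mod_cast Int.emod_lt_of_pos n hq0
  have hf : Int.fract (((n : ℝ) + v) / q) = (((n % (q : ℤ) : ℤ) : ℝ) + v) / q := by
    rw [e, Int.fract_intCast_add, Int.fract_eq_self]
    exact ⟨by positivity, by rw [div_lt_one hq']; linarith⟩
  rw [periodicLog, hf]
  congr 2
  push_cast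
  field_simp
  ring

/-- Offset of the `j`-th orbit point inside its cell. -/
noncomputable def orbitOffset (q : ℕ) (θ w : ℝ) (j : ℕ) : ℝ := w + (j * θ / q - θ / 2)

/-- The shift by `θ / 2` centres the drift `j * θ / q`, so it is at most half of `0.48`. For `w` in
`[1/4, 3/4]` the offsets therefore stay in `[0.01, 0.99]`. -/
theorem orbitOffset_bounds {q : ℕ} {θ : ℝ} (hθ : |θ| ≤ 48 / 100) (w : ℝ) {j : ℕ}
    (hj : j < q) : w - 24 / 100 ≤ orbitOffset q θ w j ∧ orbitOffset q θ w j ≤ w + 24 / 100 := by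
  have hq' : (0 : ℝ) < q := by exact_mod_cast (Nat.zero_le j).trans_lt hj
  have hj' : (j : ℝ) ≤ q := by exact_mod_cast hj.le
  have e : (j * θ / q - θ / 2 : ℝ) = θ * (j / q - 1 / 2) := by ring
  have h1 : |(j / q - 1 / 2 : ℝ)| ≤ 1 / 2 := by
    have : (j / q : ℝ) ≤ 1 := by rw [div_le_one hq']; exact hj'
    have : (0 : ℝ) ≤ j / q := by positivity
    rw [abs_le]; constructor <;> linarith
  have h2 : |(j * θ / q - θ / 2 : ℝ)| ≤ 24 / 100 := by
    rw [e, abs_mul]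
    calc _ ≤ (48 / 100 : ℝ) * (1 / 2) := by gcongr
      _ = _ := by norm_num
  rw [abs_le] at h2
  unfold orbitOffset
  constructor <;> linarith [h2.1, h2.2]

/-- The Birkhoff sum over one cell, as a function of the offset. -/
noncomputable def cellSum (q : ℕ) (θ : ℝ) (σ : ℕ → ℕ) (w : ℝ) : ℝ :=
  ∑ j ∈ range q, (-1 - Real.log (((σ j : ℝ) + 1 - orbitOffset q θ w j) / q))

theorem sum_periodicLog_eq_cellSum {q : ℕ} (hq : 1 ≤ q) {p m : ℤ} {θ w α : ℝ}
    (hθ : |θ| ≤ 48 / 100) (hα : α = p / q + θ / q ^ 2) (hw0 : 1 / 4 ≤ w) (hw1 : w ≤ 3 / 4)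
    {σ : ℕ → ℕ} (hσ : ∀ j : ℕ, (σ j : ℤ) = q - 1 - (m + j * p) % q) :
    ∑ j ∈ range q, periodicLog ((m + w - θ / 2) / q + j * α) = cellSum q θ σ w := by
  have hq' : (0 : ℝ) < q := by exact_mod_cast hq
  refine sum_congr rfl fun j hj => ?_
  have hb := orbitOffset_bounds hθ w (Finset.mem_range.1 hj)
  have e : (m + w - θ / 2) / q + j * α = (((m + j * p : ℤ) : ℝ) + orbitOffset q θ w j) / q := by
    rw [hα, orbitOffset]
    push_cast
    field_simp
    ring
  rw [e, periodicLog_grid hq _ (by linarith) (by linarith), ← hσ j]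
  push_cast
  rfl

/-- Offsets at most `0.99` give `i + 1 - v ≥ (i + 1) / 100`, so the logarithmic increments add up to
at most `100 * H` times the displacement. -/
theorem cellSum_increment {q : ℕ} {θ : ℝ} (hθ : |θ| ≤ 48 / 100) {σ : ℕ → ℕ}
    (hσ : ∀ h : ℕ → ℝ, ∑ j ∈ range q, h (σ j) = ∑ i ∈ range q, h i)
    {w w' : ℝ} (hw : w ≤ w') (hw' : w' ≤ 3 / 4) :
    0 ≤ cellSum q θ σ w' - cellSum q θ σ w ∧
      cellSum q θ σ w' - cellSum q θ σ w ≤ 100 * harmonic q * (w' - w) := by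
  have key : ∀ j ∈ range q, 0 ≤ (-1 - Real.log (((σ j : ℝ) + 1 - orbitOffset q θ w' j) / q)) -
      (-1 - Real.log (((σ j : ℝ) + 1 - orbitOffset q θ w j) / q)) ∧
      (-1 - Real.log (((σ j : ℝ) + 1 - orbitOffset q θ w' j) / q)) -
      (-1 - Real.log (((σ j : ℝ) + 1 - orbitOffset q θ w j) / q)) ≤
        100 * (w' - w) * (1 / ((σ j : ℝ) + 1)) := by
    intro j hj
    have hj' := Finset.mem_range.1 hj
    have hq' : (0 : ℝ) < q := by exact_mod_cast (Nat.zero_le j).trans_lt hj'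
    have hi : (0 : ℝ) ≤ σ j := Nat.cast_nonneg _
    have b1 := orbitOffset_bounds hθ w hj'
    have b2 := orbitOffset_bounds hθ w' hj'
    have hd : orbitOffset q θ w' j - orbitOffset q θ w j = w' - w := by
      unfold orbitOffset; ring
    rw [Real.log_div (by linarith) (by positivity), Real.log_div (by linarith) (by positivity)]
    have l1 := log_sub_log_lower (x := (σ j : ℝ) + 1 - orbitOffset q θ w' j)
      (y := (σ j : ℝ) + 1 - orbitOffset q θ w j) (by linarith) (by linarith)
    have l2 := log_sub_log_upper (x := (σ j : ℝ) + 1 - orbitOffset q θ w' j)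
      (y := (σ j : ℝ) + 1 - orbitOffset q θ w j) (by linarith) (by linarith)
    have l3 : 0 ≤ ((σ j : ℝ) + 1 - orbitOffset q θ w j - (σ j + 1 - orbitOffset q θ w' j)) /
        (σ j + 1 - orbitOffset q θ w j) := div_nonneg (by linarith) (by linarith)
    have l4 : ((σ j : ℝ) + 1 - orbitOffset q θ w j - (σ j + 1 - orbitOffset q θ w' j)) /
        (σ j + 1 - orbitOffset q θ w' j) ≤ 100 * (w' - w) * (1 / ((σ j : ℝ) + 1)) := by
      rw [show (σ j : ℝ) + 1 - orbitOffset q θ w j - (σ j + 1 - orbitOffset q θ w' j) = w' - w by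
        linarith, mul_one_div, div_le_div_iff₀ (by linarith) (by linarith)]
      nlinarith
    constructor <;> linarith
  constructor
  · rw [cellSum, cellSum, ← sum_sub_distrib]
    exact Finset.sum_nonneg fun j hj => (key j hj).1
  · rw [cellSum, cellSum, ← sum_sub_distrib]
    refine (sum_le_sum fun j hj => (key j hj).2).trans ?_
    rw [← Finset.mul_sum, hσ (fun i => 1 / ((i : ℝ) + 1)), harmonic_cast_eq]
    apply le_of_eq; ring

/-- At `w = 1/4` all offsets are at most `1/4 + 0.24 = 0.49`, and each term increases with its
offset. -/
theorem cellSum_left {q : ℕ} {θ : ℝ} (hθ : |θ| ≤ 48 / 100) {σ : ℕ → ℕ}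
    (hσ : ∀ h : ℕ → ℝ, ∑ j ∈ range q, h (σ j) = ∑ i ∈ range q, h i) :
    cellSum q θ σ (1 / 4) ≤ gridSum q (49 / 100) := by
  rw [gridSum, ← hσ (fun i => -1 - Real.log (((i : ℝ) + 1 - 49 / 100) / q))]
  refine sum_le_sum fun j hj => ?_
  have hj' := Finset.mem_range.1 hj
  have hq' : (0 : ℝ) < q := by exact_mod_cast (Nat.zero_le j).trans_lt hj'
  have hi : (0 : ℝ) ≤ σ j := Nat.cast_nonneg _
  have b1 := orbitOffset_bounds hθ (1 / 4) hj'
  gcongr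
  · exact div_pos (by linarith) hq'
  · linarith

theorem cellSum_right {q : ℕ} {θ : ℝ} (hθ : |θ| ≤ 48 / 100) {σ : ℕ → ℕ}
    (hσ : ∀ h : ℕ → ℝ, ∑ j ∈ range q, h (σ j) = ∑ i ∈ range q, h i) :
    gridSum q (51 / 100) ≤ cellSum q θ σ (3 / 4) := by
  rw [gridSum, ← hσ (fun i => -1 - Real.log (((i : ℝ) + 1 - 51 / 100) / q))]
  refine sum_le_sum fun j hj => ?_
  have hj' := Finset.mem_range.1 hj
  have hq' : (0 : ℝ) < q := by exact_mod_cast (Nat.zero_le j).trans_lt hj'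
  have hi : (0 : ℝ) ≤ σ j := Nat.cast_nonneg _
  have b1 := orbitOffset_bounds hθ (3 / 4) hj'
  gcongr
  · exact div_pos (by linarith) hq'
  · linarith

/-- In each cell there is an interval on which the Birkhoff sum is close to a given value. -/
theorem exists_cell_window {q : ℕ} (hq : 1 ≤ q) {p : ℤ} (hp : IsCoprime p (q : ℤ)) {θ α r ε : ℝ}
    (hε : 0 < ε) (hθ : |θ| ≤ 48 / 100) (hα : α = p / q + θ / q ^ 2)
    (hH : 100 * (|r| + ε + 2) ≤ harmonic q) (m : ℤ) :
    ∃ w : ℝ, 1 / 4 ≤ w ∧ w + ε / (100 * harmonic q) ≤ 3 / 4 ∧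
      ∀ w' ∈ Icc w (w + ε / (100 * harmonic q)),
        |∑ j ∈ range q, periodicLog ((m + w' - θ / 2) / q + j * α) - r| ≤ ε := by
  obtain ⟨σ, hσ, hσ'⟩ := exists_residue_perm q hq p m hp
  have hr := abs_nonneg r
  have hr1 := neg_abs_le r
  have hr2 := le_abs_self r
  have hHpos : (0 : ℝ) < harmonic q := by linarith
  -- The lower bound on the harmonic number is what places `r` and `r + ε` between the two end
  -- values.
  have hl : cellSum q θ σ (1 / 4) ≤ r := by
    linarith [cellSum_left hθ hσ, gridSum_low q hq]
  have hR : r + ε ≤ cellSum q θ σ (3 / 4) := by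
    linarith [cellSum_right hθ hσ, gridSum_high q hq]
  have hcont : ContinuousOn (cellSum q θ σ) (Icc (1 / 4) (3 / 4)) := by
    have : LipschitzOnWith (Real.toNNReal (100 * harmonic q)) (cellSum q θ σ)
        (Icc (1 / 4) (3 / 4)) := by
      refine LipschitzOnWith.of_le_add_mul _ fun x hx y hy => ?_
      rw [Real.coe_toNNReal _ (by positivity), Real.dist_eq]
      rcases le_total x y with h | h
      · have := (cellSum_increment hθ hσ h hy.2).1
        have : 0 ≤ 100 * (harmonic q : ℝ) * |x - y| := by positivity
        linarith
      · have := (cellSum_increment hθ hσ h hx.2).2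
        rw [abs_of_nonneg (by linarith)]
        linarith
    exact this.continuousOn
  obtain ⟨w, hw, hwr⟩ := intermediate_value_Icc (by norm_num) hcont ⟨hl, by linarith⟩
  have hw34 : w + ε / (100 * harmonic q) ≤ 3 / 4 := by
    have := (cellSum_increment hθ hσ hw.2 le_rfl).2
    rw [← le_sub_iff_add_le', div_le_iff₀ (by positivity)]
    linarith
  refine ⟨w, hw.1, hw34, fun w' hw' => ?_⟩
  rw [sum_periodicLog_eq_cellSum hq hθ hα (hw.1.trans hw'.1) (hw'.2.trans hw34) hσ']
  have h := cellSum_increment hθ hσ hw'.1 (hw'.2.trans hw34)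
  have h3 : 100 * harmonic q * (w' - w) ≤ ε := by
    have := hw'.2
    rw [← sub_le_iff_le_add', le_div_iff₀ (by positivity)] at this
    linarith
  rw [abs_le]
  constructor <;> linarith [h.1, h.2]

/-! ### Combs on the circle and their measures -/

/-- `E` is the image in the circle of a family of intervals of length `ℓ`, one in each cell of a
grid of mesh `1 / q`. -/
def IsComb (q : ℕ) (ℓ : ℝ) (E : Set UnitAddCircle) : Prop :=
  ∃ (x : ℤ → ℝ) (s : ℝ), (∀ m : ℤ, s + m / q ≤ x m ∧ x m + ℓ ≤ s + (m + 1) / q) ∧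
    (fun t : ℝ => (t : UnitAddCircle)) ⁻¹' E = ⋃ m, Icc (x m) (x m + ℓ)

theorem logCocycle_coe (t : ℝ) : logCocycle (t : UnitAddCircle) = periodicLog t := by
  rw [logCocycle, circleRep, periodicLog]
  have := AddCircle.coe_equivIco_mk_apply (1 : ℝ) t
  rw [this]
  simp

theorem exists_comb {q : ℕ} (hq : 1 ≤ q) {p : ℤ} (hp : IsCoprime p (q : ℤ)) {θ α r ε : ℝ}
    (hε : 0 < ε) (hθ : |θ| ≤ 48 / 100) (hα : α = p / q + θ / q ^ 2)
    (hH : 100 * (|r| + ε + 2) ≤ harmonic q) :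
    ∃ E : Set UnitAddCircle, IsComb q (ε / (100 * harmonic q * q)) E ∧
      ∀ y ∈ E, |∑ j ∈ range q, logCocycle (y + j • (α : UnitAddCircle)) - r| ≤ ε := by
  have hq0 : (0 : ℤ) < q := by exact_mod_cast hq
  have hq' : (0 : ℝ) < q := by exact_mod_cast hq
  have hHpos : (0 : ℝ) < harmonic q := by linarith [abs_nonneg r]
  choose w hw0 hw1 hw using exists_cell_window hq hp hε hθ hα hH
  set δ := ε / (100 * harmonic q) with hδ
  have hℓ : ε / (100 * harmonic q * q) = δ / q := by rw [hδ, div_div]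
  have hδ0 : 0 < δ := by positivity
  -- Using only `w (m % q)` makes the intervals invariant under integer translations, so their union
  -- is the full preimage of its image in the circle.
  set x : ℤ → ℝ := fun m => (m + w (m % q) - θ / 2) / q with hx
  have hper : ∀ m k : ℤ, x (m + k * q) = x m + k := by
    intro m k
    simp only [hx, Int.add_mul_emod_self_right]
    push_cast
    field_simp
    ring
  refine ⟨(fun t : ℝ => (t : UnitAddCircle)) '' ⋃ m, Icc (x m) (x m + δ / q), ?_, ?_⟩
  · refine ⟨x, -(θ / 2) / q, fun m => ?_, ?_⟩
    · have h0 := hw0 (m % q)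
      have h1 := hw1 (m % q)
      rw [hℓ]
      simp only [hx, ← add_div]
      constructor <;> apply div_le_div_of_nonneg_right _ hq'.le <;> linarith
    · rw [hℓ]
      ext t
      simp only [Set.mem_preimage, Set.mem_image, Set.mem_iUnion]
      constructor
      · rintro ⟨t', ⟨m, hm⟩, h⟩
        obtain ⟨k, hk⟩ := AddCircle.coe_eq_zero_iff (1 : ℝ) (x := t - t') |>.1
          (by rw [AddCircle.coe_sub, h, sub_self])
        refine ⟨m + k * q, ?_⟩
        rw [hper]
        have : t = t' + k := by simp at hk; linarith
        rw [this]
        constructor <;> linarith [hm.1, hm.2]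
      · rintro ⟨m, hm⟩
        exact ⟨t, ⟨m, hm⟩, rfl⟩
  · rintro _ ⟨t, ht, rfl⟩
    obtain ⟨m, hm⟩ := Set.mem_iUnion.1 ht
    have e : ∀ j ∈ range q, logCocycle ((t : UnitAddCircle) + j • (α : UnitAddCircle)) =
        periodicLog (t - (m / (q : ℤ) : ℤ) + j * α) := by
      intro j _
      have : (t : UnitAddCircle) + j • (α : UnitAddCircle) = ((t + j * α : ℝ) : UnitAddCircle) := by
        rw [← AddCircle.coe_nsmul, ← AddCircle.coe_add, nsmul_eq_mul]
      rw [this, logCocycle_coe, periodicLog, periodicLog, sub_add_eq_add_sub,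
        Int.fract_sub_intCast]
    dsimp only
    rw [sum_congr rfl e]
    have hmod : (m : ℝ) = (q : ℝ) * ((m / (q : ℤ) : ℤ) : ℝ) + ((m % (q : ℤ) : ℤ) : ℝ) := by
      exact_mod_cast (Int.mul_ediv_add_emod m q).symm
    have hxm : x m = (m / (q : ℤ) : ℤ) + ((m % (q : ℤ) : ℤ) + w (m % q) - θ / 2) / q := by
      simp only [hx]
      field_simp
      linarith
    have := hw (m % q) (q * (t - (m / (q : ℤ) : ℤ)) - (m % (q : ℤ) : ℤ) + θ / 2) (by
      rw [hxm] at hm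
      have h1 := hm.1
      have h2 := hm.2
      rw [add_assoc, ← add_div] at h2
      rw [← le_sub_iff_add_le', div_le_iff₀ hq'] at h1
      rw [← sub_le_iff_le_add', le_div_iff₀ hq'] at h2
      constructor <;> linarith)
    convert this using 5
    field_simp
    ring

theorem comb_cover {q : ℕ} (hq : 1 ≤ q) {ℓ s : ℝ} {x : ℤ → ℝ}
    (hx : ∀ m : ℤ, s + m / q ≤ x m ∧ x m + ℓ ≤ s + (m + 1) / q) {u v : ℝ} (huv : u ≤ v) :
    ∃ F : Finset ℤ, (F.card : ℝ) ≤ (v - u) * q + 2 ∧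
      (⋃ m, Icc (x m) (x m + ℓ)) ∩ Icc u v ⊆ ⋃ m ∈ F, Icc (x m) (x m + ℓ) := by
  have hq' : (0 : ℝ) < q := by exact_mod_cast hq
  refine ⟨Finset.Icc ⌈(u - s) * q - 1⌉ ⌊(v - s) * q⌋, ?_, ?_⟩
  · rw [Int.card_Icc]
    have h1 := Int.floor_le ((v - s) * q)
    have h2 := Int.le_ceil ((u - s) * q - 1)
    have h3 : 0 ≤ (v - u) * q := mul_nonneg (by linarith) hq'.le
    rcases le_total 0 (⌊(v - s) * q⌋ + 1 - ⌈(u - s) * q - 1⌉) with h | h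
    · have : ((⌊(v - s) * q⌋ + 1 - ⌈(u - s) * q - 1⌉).toNat : ℝ) =
          ((⌊(v - s) * q⌋ + 1 - ⌈(u - s) * q - 1⌉ : ℤ) : ℝ) := by
        exact_mod_cast Int.toNat_of_nonneg h
      rw [this]
      push_cast
      linarith
    · rw [Int.toNat_of_nonpos h]
      push_cast
      linarith
  · rintro t ⟨ht, htu, htv⟩
    obtain ⟨m, hm⟩ := Set.mem_iUnion.1 ht
    refine Set.mem_biUnion (x := m) ?_ hm
    have h1 : (m : ℝ) / q ≤ v - s := by linarith [(hx m).1, hm.1]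
    have h2 : u - s ≤ ((m : ℝ) + 1) / q := by linarith [(hx m).2, hm.2]
    rw [div_le_iff₀ hq'] at h1
    rw [le_div_iff₀ hq'] at h2
    simp only [Finset.coe_Icc, Set.mem_Icc]
    exact ⟨Int.ceil_le.2 (by linarith), Int.le_floor.2 h1⟩

theorem comb_volume_le {q : ℕ} (hq : 1 ≤ q) {ℓ s : ℝ} {x : ℤ → ℝ}
    (hx : ∀ m : ℤ, s + m / q ≤ x m ∧ x m + ℓ ≤ s + (m + 1) / q) {u v : ℝ} (huv : u ≤ v)
    (Y : Set ℝ) {C : ℝ} (hC : 0 ≤ C)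
    (hY : ∀ m, volume (Y ∩ Icc (x m) (x m + ℓ)) ≤ ENNReal.ofReal C) :
    volume (Y ∩ ((⋃ m, Icc (x m) (x m + ℓ)) ∩ Icc u v)) ≤
      ENNReal.ofReal (((v - u) * q + 2) * C) := by
  obtain ⟨F, hF, hsub⟩ := comb_cover hq hx huv
  calc _ ≤ volume (⋃ m ∈ F, Y ∩ Icc (x m) (x m + ℓ)) := by
        apply measure_mono
        rw [← Set.inter_iUnion₂]
        exact Set.inter_subset_inter_right _ hsub
    _ ≤ ∑ m ∈ F, volume (Y ∩ Icc (x m) (x m + ℓ)) := measure_biUnion_finset_le _ _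
    _ ≤ ∑ m ∈ F, ENNReal.ofReal C := sum_le_sum fun m _ => hY m
    _ = ENNReal.ofReal (F.card * C) := by
        rw [Finset.sum_const, nsmul_eq_mul, ENNReal.ofReal_mul (by positivity),
          ENNReal.ofReal_natCast]
    _ ≤ _ := by gcongr

theorem circleRep_measurable : Measurable circleRep :=
  measurable_subtype_coe.comp (AddCircle.measurableEquivIco (1 : ℝ) 0).measurable

theorem coe_circleRep (y : UnitAddCircle) : (circleRep y : UnitAddCircle) = y :=
  (AddCircle.equivIco (1 : ℝ) 0).symm_apply_apply y

theorem measurableSet_of_preimage_coe {E : Set UnitAddCircle}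
    (h : MeasurableSet ((fun t : ℝ => (t : UnitAddCircle)) ⁻¹' E)) : MeasurableSet E := by
  have := circleRep_measurable h
  rw [← Set.preimage_comp] at this
  convert this using 1
  ext y
  simp [coe_circleRep]

theorem IsComb.measurableSet {q : ℕ} {ℓ : ℝ} {E : Set UnitAddCircle} (h : IsComb q ℓ E) :
    MeasurableSet E := by
  obtain ⟨x, s, -, h⟩ := h
  apply measurableSet_of_preimage_coe
  rw [h]
  exact MeasurableSet.iUnion fun m => measurableSet_Icc

theorem volume_eq_volume_preimage {E : Set UnitAddCircle} (hE : MeasurableSet E) :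
    volume E = volume (((fun t : ℝ => (t : UnitAddCircle)) ⁻¹' E) ∩ Ioc 0 1) := by
  have := (UnitAddCircle.measurePreserving_mk 0).measure_preimage hE.nullMeasurableSet
  rw [← this, Measure.restrict_apply]
  · simp
  · exact (UnitAddCircle.measurePreserving_mk 0).measurable hE

theorem IsComb.real_le {q : ℕ} {ℓ : ℝ} {E : Set UnitAddCircle} (h : IsComb q ℓ E) (hq : 1 ≤ q)
    (hℓ : 0 ≤ ℓ) : volume.real E ≤ 3 * (q * ℓ) := by
  have hE := h.measurableSet
  obtain ⟨x, s, hx, h⟩ := h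
  have hq' : (1 : ℝ) ≤ q := by exact_mod_cast hq
  refine ENNReal.toReal_le_of_le_ofReal (by positivity) ?_
  rw [volume_eq_volume_preimage hE, h]
  calc _ ≤ volume (Set.univ ∩ ((⋃ m, Icc (x m) (x m + ℓ)) ∩ Icc 0 1)) := by
        rw [Set.univ_inter]
        exact measure_mono (Set.inter_subset_inter_right _ Set.Ioc_subset_Icc_self)
    _ ≤ _ := comb_volume_le hq hx zero_le_one Set.univ hℓ (by simp)
    _ ≤ _ := by
        apply ENNReal.ofReal_le_ofReal
        nlinarith

/-- At most `q + 2 ≤ 3 * q` teeth of the first comb meet the unit interval, and each meets at most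
`ℓ * q' + 2` teeth of the second. -/
theorem IsComb.real_inter_le {q q' : ℕ} {ℓ ℓ' : ℝ} {E E' : Set UnitAddCircle} (h : IsComb q ℓ E)
    (h' : IsComb q' ℓ' E') (hq : 1 ≤ q) (hq' : 1 ≤ q') (hℓ : 0 ≤ ℓ) (hℓ' : 0 ≤ ℓ') :
    volume.real (E ∩ E') ≤ 3 * q * ((ℓ * q' + 2) * ℓ') := by
  have hE := h.measurableSet.inter h'.measurableSet
  obtain ⟨x, s, hx, h⟩ := h
  obtain ⟨x', s', hx', h'⟩ := h'
  have hqr : (1 : ℝ) ≤ q := by exact_mod_cast hq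
  have hC : 0 ≤ (ℓ * q' + 2) * ℓ' := by positivity
  refine ENNReal.toReal_le_of_le_ofReal (by positivity) ?_
  rw [volume_eq_volume_preimage hE, Set.preimage_inter, h, h']
  set X' := ⋃ m, Icc (x' m) (x' m + ℓ')
  calc _ ≤ volume (X' ∩ ((⋃ m, Icc (x m) (x m + ℓ)) ∩ Icc 0 1)) := by
        apply measure_mono
        rintro t ⟨⟨h1, h2⟩, h3⟩
        exact ⟨h2, h1, Set.Ioc_subset_Icc_self h3⟩
    _ ≤ _ := by
        refine comb_volume_le hq hx zero_le_one X' hC fun m => ?_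
        have := comb_volume_le hq' hx' (u := x m) (v := x m + ℓ) (by linarith) Set.univ hℓ'
          (by simp)
        rw [Set.univ_inter, add_sub_cancel_left] at this
        exact this
    _ ≤ _ := by
        apply ENNReal.ofReal_le_ofReal
        nlinarith

theorem IsComb.preimage_add {q : ℕ} {ℓ : ℝ} {E : Set UnitAddCircle} (h : IsComb q ℓ E)
    (β : UnitAddCircle) : IsComb q ℓ ((fun y => y + β) ⁻¹' E) := by
  obtain ⟨x, s, hx, h⟩ := h
  refine ⟨fun m => x m - circleRep β, s - circleRep β, fun m => ?_, ?_⟩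
  · have := hx m
    constructor <;> linarith
  · ext t
    have : t ∈ (fun t : ℝ => (t : UnitAddCircle)) ⁻¹' ((fun y => y + β) ⁻¹' E) ↔
        t + circleRep β ∈ (fun t : ℝ => (t : UnitAddCircle)) ⁻¹' E := by
      simp [coe_circleRep]
    rw [this, h]
    simp only [Set.mem_iUnion, Set.mem_Icc]
    refine exists_congr fun m => ?_
    constructor <;> rintro ⟨h1, h2⟩ <;> constructor <;> linarith

/-- Within a cell `ψ` differs by at most `ω` from its value at the left end of the tooth, so the
tooth carries at least the share `q * ℓ` of the cell integral, up to `2 * ω * ℓ`. -/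
theorem IsComb.le_setIntegral {q : ℕ} {ℓ : ℝ} {E : Set UnitAddCircle} (h : IsComb q ℓ E)
    (hq : 1 ≤ q) (hℓ : 0 ≤ ℓ) {ψ : UnitAddCircle → ℝ} (hψ : Continuous ψ) (hψ0 : ∀ y, 0 ≤ ψ y)
    {ω : ℝ} (hω : ∀ y z, dist y z ≤ 1 / q → |ψ y - ψ z| ≤ ω) :
    q * ℓ * (∫ y, ψ y) - 2 * ω * (q * ℓ) ≤ ∫ y in E, ψ y := by
  have hE := h.measurableSet
  obtain ⟨x, s, hx, h⟩ := h
  have hqr : (0 : ℝ) < q := by exact_mod_cast hq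
  set g : ℝ → ℝ := fun t => ψ (t : UnitAddCircle) with hg
  have hgc : Continuous g := hψ.comp (AddCircle.continuous_mk' 1)
  set c : ℕ → ℝ := fun m => s + m / q with hc
  have hcm : ∀ m, c m ≤ c (m + 1) := fun m => by
    simp only [hc]; gcongr; simp
  have hX : MeasurableSet (⋃ m, Icc (x m) (x m + ℓ)) :=
    MeasurableSet.iUnion fun m => measurableSet_Icc
  set f : ℝ → ℝ := (⋃ m, Icc (x m) (x m + ℓ)).indicator g with hf
  have hfi : ∀ a b, IntervalIntegrable f volume a b := fun a b => by
    have := hgc.intervalIntegrable (μ := volume) a b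
    rw [intervalIntegrable_iff] at this ⊢
    exact this.indicator hX
  have hc0 : c 0 = s := by simp [hc]
  have hcq : c q = s + 1 := by simp [hc, hqr.ne']
  have I1 : ∫ y, ψ y = ∑ m ∈ range q, ∫ t in (c m)..(c (m + 1)), g t := by
    rw [intervalIntegral.sum_integral_adjacent_intervals
      (fun _ _ => hgc.intervalIntegrable _ _), hc0, hcq]
    exact (UnitAddCircle.intervalIntegral_preimage s ψ).symm
  have I2 : ∫ y in E, ψ y = ∑ m ∈ range q, ∫ t in (c m)..(c (m + 1)), f t := by
    rw [intervalIntegral.sum_integral_adjacent_intervals (fun _ _ => hfi _ _), hc0, hcq,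
      ← integral_indicator hE, ← UnitAddCircle.intervalIntegral_preimage s]
    congr 1
    ext t
    rw [hf, ← h]
    rfl
  rw [I1, I2, Finset.mul_sum]
  have key : ∀ m ∈ range q, q * ℓ * (∫ t in (c m)..(c (m + 1)), g t) - 2 * ω * ℓ ≤
      ∫ t in (c m)..(c (m + 1)), f t := by
    intro m _
    have hxm := hx (m : ℤ)
    push_cast at hxm
    have e1 : c m = s + m / q := rfl
    have e2 : c (m + 1) = s + (m + 1) / q := by simp [hc]
    have e3 : c (m + 1) = c m + 1 / q := by rw [e1, e2]; ring
    rw [← e1, ← e2] at hxm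
    have osc : ∀ t ∈ Icc (c m) (c (m + 1)), |g t - g (x m)| ≤ ω := by
      intro t ht
      apply hω
      rw [dist_eq_norm, ← AddCircle.coe_sub]
      rw [UnitAddCircle.norm_eq]
      refine (round_le (t - x m) 0).trans ?_
      rw [Int.cast_zero, sub_zero, abs_le]
      constructor <;> linarith [ht.1, ht.2]
    have u1 : ∫ t in (c m)..(c (m + 1)), g t ≤ (g (x m) + ω) * (1 / q) := by
      calc _ ≤ ∫ t in (c m)..(c (m + 1)), (g (x m) + ω) := by
            apply intervalIntegral.integral_mono_on (hcm m) (hgc.intervalIntegrable _ _) (by simp)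
            intro t ht
            linarith [(abs_le.1 (osc t ht)).2]
        _ = _ := by rw [intervalIntegral.integral_const, e3, smul_eq_mul]; ring
    have u2 : ℓ * (g (x m) - ω) ≤ ∫ t in (x m)..(x m + ℓ), f t := by
      calc _ = ∫ t in (x m)..(x m + ℓ), (g (x m) - ω) := by
            rw [intervalIntegral.integral_const, smul_eq_mul]; ring
        _ ≤ _ := by
            apply intervalIntegral.integral_mono_on (by linarith) (by simp) (hfi _ _)
            intro t ht
            have : f t = g t := Set.indicator_of_mem
              (show t ∈ ⋃ m, Icc (x m) (x m + ℓ) from Set.mem_iUnion.2 ⟨(m : ℤ), ht⟩) _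
            rw [this]
            linarith [(abs_le.1 (osc t ⟨by linarith [ht.1], by linarith [ht.2]⟩)).1]
    have u3 : ∫ t in (x m)..(x m + ℓ), f t ≤ ∫ t in (c m)..(c (m + 1)), f t := by
      apply intervalIntegral.integral_mono_interval hxm.1 (by linarith) hxm.2
      · exact Eventually.of_forall fun t => Set.indicator_nonneg (fun t _ => hψ0 _) t
      · exact hfi _ _
    have u4 := mul_le_mul_of_nonneg_left u1 (show 0 ≤ q * ℓ by positivity)
    have u5 : q * ℓ * ((g (x m) + ω) * (1 / q)) = ℓ * (g (x m) + ω) := by field_simp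
    linarith
  have := sum_le_sum key
  rw [sum_sub_distrib] at this
  simp only [Finset.sum_const, Finset.card_range, nsmul_eq_mul] at this
  linarith

/-! ### Quasi-independence and averaging along combs -/

theorem integrable_of_bounded {f : UnitAddCircle → ℝ} (hf : Measurable f) {K : ℝ}
    (hK : ∀ y, |f y| ≤ K) : Integrable f :=
  Integrable.of_bound hf.aestronglyMeasurable K (Eventually.of_forall hK)

/-- A sequence of combs satisfying the quasi-independence condition. -/
structure CombSequence (q : ℕ → ℕ) (ℓ : ℕ → ℝ) (E : ℕ → Set UnitAddCircle) : Prop where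
  comb : ∀ k, IsComb (q k) (ℓ k) (E k)
  one_le : ∀ k, 1 ≤ q k
  pos : ∀ k, 0 ≤ ℓ k
  sep : ∀ j k, j < k → (q j : ℝ) ≤ (q j * ℓ j) * q k

/-- The field `sep` says `1 ≤ ℓ j * q k`: a tooth of the coarser comb is at least one cell of the
finer comb long. The count `ℓ j * q k + 2` is then at most `3 * (ℓ j * q k)`. -/
theorem CombSequence.real_inter_le {q : ℕ → ℕ} {ℓ : ℕ → ℝ} {E : ℕ → Set UnitAddCircle}
    (h : CombSequence q ℓ E) (j k : ℕ) :
    volume.real (E j ∩ E k) ≤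
      9 * ((q j * ℓ j) * (q k * ℓ k)) + if j = k then 3 * (q j * ℓ j) else 0 := by
  have lt : ∀ j k, j < k → volume.real (E j ∩ E k) ≤ 9 * ((q j * ℓ j) * (q k * ℓ k)) := by
    intro j k hjk
    have h1 := (h.comb j).real_inter_le (h.comb k) (h.one_le j) (h.one_le k) (h.pos j) (h.pos k)
    have h2 := mul_le_mul_of_nonneg_right (h.sep j k hjk) (h.pos k)
    linarith
  rcases lt_trichotomy j k with hjk | rfl | hjk
  · rw [if_neg hjk.ne, add_zero]
    exact lt j k hjk
  · rw [if_pos rfl, Set.inter_self]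
    have := (h.comb j).real_le (h.one_le j) (h.pos j)
    nlinarith [sq_nonneg (q j * ℓ j)]
  · rw [if_neg hjk.ne', add_zero, Set.inter_comm, mul_comm (_ * _ : ℝ)]
    exact lt k j hjk

theorem CombSequence.integral_sq_le {q : ℕ → ℕ} {ℓ : ℕ → ℝ} {E : ℕ → Set UnitAddCircle}
    (h : CombSequence q ℓ E) (F : Finset ℕ) (hM : 1 ≤ ∑ k ∈ F, q k * ℓ k) :
    ∫ y, (∑ k ∈ F, (E k).indicator (fun _ => (1 : ℝ)) y) ^ 2 ≤ 12 * (∑ k ∈ F, q k * ℓ k) ^ 2 := by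
  have e : ∀ y, (∑ k ∈ F, (E k).indicator (fun _ => (1 : ℝ)) y) ^ 2 =
      ∑ j ∈ F, ∑ k ∈ F, (E j ∩ E k).indicator (fun _ => (1 : ℝ)) y := by
    intro y
    rw [sq, Finset.sum_mul_sum]
    refine sum_congr rfl fun j _ => sum_congr rfl fun k _ => ?_
    by_cases h1 : y ∈ E j <;> by_cases h2 : y ∈ E k <;> simp [h1, h2]
  have hm : ∀ j k, MeasurableSet (E j ∩ E k) := fun j k =>
    (h.comb j).measurableSet.inter (h.comb k).measurableSet
  have hi : ∀ j k, Integrable ((E j ∩ E k).indicator (fun _ => (1 : ℝ))) volume := fun j k =>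
    (integrable_const 1).indicator (hm j k)
  simp_rw [e]
  rw [integral_finsetSum _ fun j _ => integrable_finsetSum _ fun k _ => hi j k]
  have e2 : ∀ j ∈ F, ∫ y, ∑ k ∈ F, (E j ∩ E k).indicator (fun _ => (1 : ℝ)) y =
      ∑ k ∈ F, volume.real (E j ∩ E k) := by
    intro j _
    rw [integral_finsetSum _ fun k _ => hi j k]
    refine sum_congr rfl fun k _ => ?_
    rw [integral_indicator (hm j k)]
    simp
  rw [sum_congr rfl e2]
  calc _ ≤ ∑ j ∈ F, ∑ k ∈ F, (9 * ((q j * ℓ j) * (q k * ℓ k)) +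
        if j = k then 3 * (q j * ℓ j) else 0) :=
        sum_le_sum fun j _ => sum_le_sum fun k _ => h.real_inter_le j k
    _ = 9 * (∑ k ∈ F, q k * ℓ k) ^ 2 + 3 * ∑ k ∈ F, q k * ℓ k := by
        simp_rw [sum_add_distrib, Finset.sum_ite_eq]
        rw [sq, Finset.sum_mul_sum, Finset.mul_sum, Finset.mul_sum]
        congr 1
        · exact sum_congr rfl fun j _ => by rw [Finset.mul_sum]
        · exact sum_congr rfl fun j hj => by rw [if_pos hj]
    _ ≤ _ := by nlinarith

/-- Cauchy–Schwarz against the counting function `W` of the combs, whose second moment is at most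
`12 * M ^ 2`; a small `L²` error thus remains small on average over the batch, although each comb
has small mass. -/
theorem CombSequence.sum_setIntegral_le {q : ℕ → ℕ} {ℓ : ℕ → ℝ} {E : ℕ → Set UnitAddCircle}
    (h : CombSequence q ℓ E) (F : Finset ℕ) (hM : 1 ≤ ∑ k ∈ F, q k * ℓ k)
    {f : UnitAddCircle → ℝ} (hf : Measurable f) {K η : ℝ} (hK : ∀ y, |f y| ≤ K) (hη : 0 < η)
    (hf2 : ∫ y, f y ^ 2 ≤ η ^ 2) :
    ∑ k ∈ F, ∫ y in E k, f y ≤ 7 * η * ∑ k ∈ F, q k * ℓ k := by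
  set M := ∑ k ∈ F, (q k * ℓ k : ℝ) with hMdef
  set W : UnitAddCircle → ℝ := fun y => ∑ k ∈ F, (E k).indicator (fun _ => (1 : ℝ)) y with hW
  have hWm : Measurable W := Finset.measurable_sum _ fun k _ =>
    measurable_const.indicator (h.comb k).measurableSet
  have hWb : ∀ y, |W y| ≤ F.card := by
    intro y
    refine (Finset.abs_sum_le_sum_abs _ _).trans ?_
    calc _ ≤ ∑ k ∈ F, (1 : ℝ) := sum_le_sum fun k _ => by
          by_cases hy : y ∈ E k <;> simp [hy]
      _ = _ := by simp
  have hK0 : 0 ≤ K := (abs_nonneg _).trans (hK 0)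
  have hfi : Integrable f := integrable_of_bounded hf hK
  have hf2i : Integrable (fun y => f y ^ 2) := integrable_of_bounded (hf.pow_const 2) (K := K ^ 2)
    fun y => by rw [abs_pow]; exact pow_le_pow_left₀ (abs_nonneg _) (hK y) 2
  have hW2i : Integrable (fun y => W y ^ 2) := integrable_of_bounded (hWm.pow_const 2)
    (K := (F.card : ℝ) ^ 2)
    fun y => by rw [abs_pow]; exact pow_le_pow_left₀ (abs_nonneg _) (hWb y) 2
  have hfWi : Integrable (fun y => f y * W y) := integrable_of_bounded (hf.mul hWm)
    (K := K * F.card)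
    fun y => by rw [abs_mul]; exact mul_le_mul (hK y) (hWb y) (abs_nonneg _) hK0
  have e : ∑ k ∈ F, ∫ y in E k, f y = ∫ y, f y * W y := by
    simp_rw [hW, Finset.mul_sum]
    rw [integral_finsetSum]
    · refine sum_congr rfl fun k _ => ?_
      rw [← integral_indicator (h.comb k).measurableSet]
      congr 1
      ext y
      by_cases hy : y ∈ E k <;> simp [hy]
    · intro k _
      have := hfi.indicator (h.comb k).measurableSet
      convert! this using 1
      ext y
      by_cases hy : y ∈ E k <;> simp [hy]
  rw [e]
  -- Weighted AM–GM, with weights balancing the two second moments `η ^ 2` and `M ^ 2`.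
  have hpt : ∀ y, f y * W y ≤ (M / η) / 2 * f y ^ 2 + (η / M) / 2 * W y ^ 2 := by
    intro y
    have hM0 : M ≠ 0 := by linarith
    have : (M / η) / 2 * f y ^ 2 + (η / M) / 2 * W y ^ 2 - f y * W y =
        (M / η) / 2 * (f y - η / M * W y) ^ 2 := by field_simp; ring
    have : 0 ≤ (M / η) / 2 * (f y - η / M * W y) ^ 2 := by positivity
    linarith
  have hsum : Integrable (fun y => (M / η) / 2 * f y ^ 2 + (η / M) / 2 * W y ^ 2) :=
    (hf2i.const_mul _).add (hW2i.const_mul _)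
  have s1 := integral_mono hfWi hsum hpt
  rw [integral_add (hf2i.const_mul _) (hW2i.const_mul _), integral_const_mul,
    integral_const_mul] at s1
  have s2 := mul_le_mul_of_nonneg_left hf2 (show 0 ≤ (M / η) / 2 by positivity)
  have s3 := mul_le_mul_of_nonneg_left (h.integral_sq_le F hM) (show 0 ≤ (η / M) / 2 by positivity)
  have s4 : (M / η) / 2 * η ^ 2 + (η / M) / 2 * (12 * M ^ 2) = 13 / 2 * (η * M) := by
    have : M ≠ 0 := by linarith
    field_simp
    ring
  have s5 : 0 ≤ η * M := by positivity
  linarith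

theorem integral_abs_le_of_integral_sq_le {f : UnitAddCircle → ℝ} (hf : Measurable f) {K η : ℝ}
    (hK : ∀ y, |f y| ≤ K) (hη : 0 < η) (hf2 : ∫ y, f y ^ 2 ≤ η ^ 2) : ∫ y, |f y| ≤ η := by
  have hf2i : Integrable (fun y => f y ^ 2) := integrable_of_bounded (hf.pow_const 2) (K := K ^ 2)
    fun y => by rw [abs_pow]; exact pow_le_pow_left₀ (abs_nonneg _) (hK y) 2
  have hpt : ∀ y, |f y| ≤ 1 / (2 * η) * f y ^ 2 + η / 2 := by
    intro y
    have : 1 / (2 * η) * f y ^ 2 + η / 2 - |f y| = 1 / (2 * η) * (|f y| - η) ^ 2 := by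
      rw [sub_sq, sq_abs]; field_simp; ring
    have : 0 ≤ 1 / (2 * η) * (|f y| - η) ^ 2 := by positivity
    linarith
  have hsum : Integrable (fun y => 1 / (2 * η) * f y ^ 2 + η / 2) :=
    (hf2i.const_mul _).add (integrable_const _)
  have s1 := integral_mono (integrable_of_bounded hf hK).abs hsum hpt
  rw [integral_add (hf2i.const_mul _) (integrable_const _), integral_const_mul] at s1
  have s2 := mul_le_mul_of_nonneg_left hf2 (show 0 ≤ 1 / (2 * η) by positivity)
  have s3 : 1 / (2 * η) * η ^ 2 + η / 2 = η := by field_simp; ring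
  simp only [integral_const, measureReal_def, UnitAddCircle.measure_univ, ENNReal.toReal_one,
    smul_eq_mul, one_mul] at s1
  linarith

theorem exists_continuous_approx {a : UnitAddCircle → ℝ} (ha : Measurable a) {K : ℝ}
    (hK : ∀ y, |a y| ≤ K) {η : ℝ} (hη : 0 < η) :
    ∃ g : UnitAddCircle → ℝ, Continuous g ∧ ∃ K' : ℝ, (∀ y, |a y - g y| ≤ K') ∧
      ∫ y, (a y - g y) ^ 2 ≤ η ^ 2 := by
  have hL : MemLp a (ENNReal.ofReal 2) volume :=
    MemLp.of_bound ha.aestronglyMeasurable K (Eventually.of_forall hK)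
  obtain ⟨g, hg, -⟩ := hL.exists_boundedContinuous_integral_rpow_sub_le (by norm_num)
    (show 0 < η ^ 2 by positivity)
  refine ⟨g, g.continuous, K + ‖g‖, fun y => ?_, ?_⟩
  · exact (abs_sub _ _).trans (add_le_add (hK y) (g.norm_coe_le_norm y))
  · simpa using hg

theorem setIntegral_comp_add (h : UnitAddCircle → ℝ) {E : Set UnitAddCircle}
    (hE : MeasurableSet E) (β : UnitAddCircle) :
    ∫ y in E, h (y + β) = ∫ y in (fun y => y + -β) ⁻¹' E, h y := by
  have hE' : MeasurableSet ((fun y => y + -β) ⁻¹' E) := (measurable_id.add_const _) hE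
  rw [← integral_indicator hE, ← integral_indicator hE',
    ← integral_add_right_eq_self (((fun y => y + -β) ⁻¹' E).indicator h) β]
  congr 1
  ext y
  by_cases hy : y ∈ E <;> simp [Set.indicator, hy]

theorem CombSequence.preimage_add {q : ℕ → ℕ} {ℓ : ℕ → ℝ} {E : ℕ → Set UnitAddCircle}
    (h : CombSequence q ℓ E) (β : ℕ → UnitAddCircle) :
    CombSequence q ℓ (fun k => (fun y => y + β k) ⁻¹' E k) :=
  ⟨fun k => (h.comb k).preimage_add (β k), h.one_le, h.pos, h.sep⟩

/-- Functions `a` and `b` which nearly match along a recurrent sequence of combs are close in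
mean. -/
theorem CombSequence.integral_abs_sub_le {q : ℕ → ℕ} {ℓ : ℕ → ℝ} {E : ℕ → Set UnitAddCircle}
    (h : CombSequence q ℓ E)
    (hdiv : ∀ k₀, ∃ F : Finset ℕ, (∀ k ∈ F, k₀ ≤ k) ∧ 1 ≤ ∑ k ∈ F, q k * ℓ k)
    (hq : Tendsto q atTop atTop) {β : ℕ → UnitAddCircle} (hβ : Tendsto β atTop (𝓝 0))
    {a b : UnitAddCircle → ℝ} (ha : Measurable a) (hb : Measurable b) {K : ℝ}
    (haK : ∀ y, |a y| ≤ K) (hbK : ∀ y, |b y| ≤ K) {δ : ℝ}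
    (hab : ∀ k, ∀ y ∈ E k, |b (y + β k) - a y| ≤ δ) (hδ : 0 ≤ δ) :
    ∫ y, |b y - a y| ≤ 3 * δ := by
  refine le_of_forall_pos_le_add fun ε hε => ?_
  -- The total is `2 + 3 + 7 + 7 = 19` errors `η` from the averaging and 2 more from replacing `a`,
  -- `b` by continuous functions.
  set η := ε / 21 with hη
  have hη0 : 0 < η := by positivity
  obtain ⟨a', ha'c, Ka, hKa, ha2⟩ := exists_continuous_approx ha haK hη0
  obtain ⟨b', hb'c, Kb, hKb, hb2⟩ := exists_continuous_approx hb hbK hη0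
  set ψ : UnitAddCircle → ℝ := fun y => |b' y - a' y| with hψ
  have hψc : Continuous ψ := (hb'c.sub ha'c).abs
  obtain ⟨d₁, hd₁, hu₁⟩ := Metric.uniformContinuous_iff.1
    (CompactSpace.uniformContinuous_of_continuous hψc) η hη0
  obtain ⟨d₂, hd₂, hu₂⟩ := Metric.uniformContinuous_iff.1
    (CompactSpace.uniformContinuous_of_continuous hb'c) η hη0
  have hq1 : ∀ᶠ k in atTop, 1 / (q k : ℝ) < d₁ := by
    have : Tendsto (fun k => 1 / (q k : ℝ)) atTop (𝓝 0) := by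
      simp_rw [one_div]
      exact tendsto_inv_atTop_zero.comp (tendsto_natCast_atTop_atTop.comp hq)
    exact this.eventually (gt_mem_nhds hd₁)
  have hβ1 : ∀ᶠ k in atTop, dist (β k) 0 < d₂ := (Metric.tendsto_nhds.1 hβ) d₂ hd₂
  obtain ⟨k₀, hk₀⟩ := eventually_atTop.1 (hq1.and hβ1)
  obtain ⟨F, hF, hM⟩ := hdiv k₀
  have ham : Measurable (fun y => |a y - a' y|) := (ha.sub ha'c.measurable).abs
  have hbm : Measurable (fun y => |b y - b' y|) := (hb.sub hb'c.measurable).abs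
  have hKa' : ∀ y, |(|a y - a' y|)| ≤ Ka := fun y => by rw [abs_abs]; exact hKa y
  have hKb' : ∀ y, |(|b y - b' y|)| ≤ Kb := fun y => by rw [abs_abs]; exact hKb y
  have hai := integrable_of_bounded ham hKa'
  have hbi := integrable_of_bounded hbm hKb'
  have hψi : Integrable ψ := hψc.integrable_of_hasCompactSupport
    (HasCompactSupport.of_compactSpace ψ)
  have A := h.sum_setIntegral_le F hM ham hKa' hη0 (by simpa only [sq_abs] using ha2)
  -- The error of `b` is evaluated at `y + β k`; translating moves it onto shifted combs, which
  -- satisfy the same bounds.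
  have B := (h.preimage_add fun k => -β k).sum_setIntegral_le F hM hbm hKb' hη0
    (by simpa only [sq_abs] using hb2)
  have step : ∀ k ∈ F, q k * ℓ k * (∫ y, ψ y) - 2 * η * (q k * ℓ k) ≤
      (η + δ) * (3 * (q k * ℓ k)) + (∫ y in (fun y => y + -β k) ⁻¹' E k, |b y - b' y|) +
        ∫ y in E k, |a y - a' y| := by
    intro k hk
    have hEm := (h.comb k).measurableSet
    refine ((h.comb k).le_setIntegral (h.one_le k) (h.pos k) hψc (fun y => abs_nonneg _)
      (ω := η) fun y z hyz => ?_).trans ?_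
    · exact (hu₁ (hyz.trans_lt (hk₀ k (hF k hk)).1)).le
    · have hbi' : Integrable (fun y => |b (y + β k) - b' (y + β k)|) := hbi.comp_add_right (β k)
      have hpt : ∀ y ∈ E k, ψ y ≤
          ((η + δ) + |b (y + β k) - b' (y + β k)|) + |a y - a' y| := by
        intro y hy
        have h1 : |b' (y + β k) - b' y| < η := by
          apply hu₂
          rw [dist_eq_norm, add_sub_cancel_left, ← dist_zero_right]
          exact (hk₀ k (hF k hk)).2
        have h2 := hab k y hy
        have e : b' y - a' y = -(b' (y + β k) - b' y) + -(b (y + β k) - b' (y + β k)) +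
            (b (y + β k) - a y) + (a y - a' y) := by ring
        have h3 : ψ y ≤ |b' (y + β k) - b' y| + |b (y + β k) - b' (y + β k)| +
            |b (y + β k) - a y| + |a y - a' y| := by
          simp only [hψ]
          rw [e]
          refine (abs_add_le _ _).trans (add_le_add_left ?_ _)
          refine (abs_add_le _ _).trans (add_le_add_left ?_ _)
          refine (abs_add_le _ _).trans ?_
          rw [abs_neg, abs_neg]
        linarith
      have hci : Integrable (fun _ : UnitAddCircle => η + δ) volume := integrable_const _
      have hcbi : Integrable (fun y => (η + δ) + |b (y + β k) - b' (y + β k)|) := hci.add hbi'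
      have s1 := setIntegral_mono_on hψi.integrableOn
        (hcbi.add hai).integrableOn hEm hpt
      simp only [Pi.add_apply] at s1
      rw [integral_add hcbi.integrableOn hai.integrableOn,
        integral_add hci.integrableOn hbi'.integrableOn,
        setIntegral_comp_add (fun y => |b y - b' y|) hEm, setIntegral_const, smul_eq_mul] at s1
      have s2 := mul_le_mul_of_nonneg_right ((h.comb k).real_le (h.one_le k) (h.pos k))
        (show 0 ≤ η + δ by linarith)
      linarith
  have S := sum_le_sum step
  rw [sum_sub_distrib, sum_add_distrib, sum_add_distrib, ← Finset.sum_mul, ← Finset.mul_sum,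
    ← Finset.mul_sum, ← Finset.mul_sum] at S
  set M := ∑ k ∈ F, (q k * ℓ k : ℝ) with hMd
  have hψ3 : ∫ y, ψ y ≤ 3 * δ + 19 * η := by
    have hM0 : 0 < M := by linarith
    have : M * (∫ y, ψ y) ≤ M * (3 * δ + 19 * η) := by linarith
    exact le_of_mul_le_mul_left this hM0
  have A1 := integral_abs_le_of_integral_sq_le (ha.sub ha'c.measurable) hKa hη0 ha2
  have B1 := integral_abs_le_of_integral_sq_le (hb.sub hb'c.measurable) hKb hη0 hb2
  have hbai : Integrable (fun y => |b y - a y|) :=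
    ((integrable_of_bounded hb hbK).sub (integrable_of_bounded ha haK)).abs
  have hψbi : Integrable (fun y => ψ y + |b y - b' y|) := hψi.add hbi
  have fin := integral_mono hbai (hψbi.add hai) (fun y => by
    have e : b y - a y = (b' y - a' y) + (b y - b' y) + -(a y - a' y) := by ring
    simp only [Pi.add_apply, hψ]
    rw [e]
    refine (abs_add_le _ _).trans ?_
    rw [abs_neg]
    exact add_le_add_left (abs_add_le _ _) _)
  simp only [Pi.add_apply] at fin
  rw [integral_add hψbi hai, integral_add hψi hbi] at fin
  simp only [Pi.sub_apply] at A1 B1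
  have : 21 * η = ε := by rw [hη]; ring
  linarith

/-! ### Rational approximation by Farey neighbours -/

/-- Neighbours in the Farey sequence of order `Q` around `α`. -/
theorem exists_farey_neighbours (α : ℝ) (Q : ℕ) (hQ : 1 ≤ Q) :
    ∃ (a c : ℤ) (b d : ℕ), 1 ≤ b ∧ b ≤ Q ∧ 1 ≤ d ∧ d ≤ Q ∧ Q < b + d ∧
      (b * c - a * d : ℤ) = 1 ∧ (a : ℝ) ≤ b * α ∧ d * α ≤ c := by
  induction Q, hQ using Nat.le_induction with
  | base =>
    refine ⟨⌊α⌋, ⌊α⌋ + 1, 1, 1, le_rfl, le_rfl, le_rfl, le_rfl, by norm_num, by push_cast; ring, ?_, ?_⟩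
    · simpa using Int.floor_le α
    · simpa using (Int.lt_floor_add_one α).le
  | succ Q hQ ih =>
    obtain ⟨a, c, b, d, hb1, hb, hd1, hd, hbd, hdet, h1, h2⟩ := ih
    by_cases h : Q + 1 < b + d
    · exact ⟨a, c, b, d, hb1, by omega, hd1, by omega, h, hdet, h1, h2⟩
    · rcases le_total ((a : ℝ) + c) ((b + d) * α) with h' | h'
      · refine ⟨a + c, c, b + d, d, by omega, by omega, hd1, by omega, by omega, ?_, ?_, h2⟩
        · push_cast; linear_combination hdet
        · push_cast; exact h'
      · refine ⟨a, a + c, b, b + d, hb1, by omega, by omega, by omega, by omega, ?_, h1, ?_⟩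
        · push_cast; linear_combination hdet
        · push_cast; exact h'

/-- A weak form of Hurwitz's inequality for a pair of neighbours and their mediant. -/
theorem hurwitz_trichotomy {b d X Y : ℝ} (hb : 0 < b) (hd : 0 < d)
    (h : d * X + b * Y = 1) :
    b * X ≤ 48 / 100 ∨ d * Y ≤ 48 / 100 ∨ (b + d) * |X - Y| ≤ 48 / 100 := by
  by_contra! H
  obtain ⟨hu, hv, hw⟩ := H
  have e : (d * X) * (b * Y) = (b * X) * (d * Y) := by ring
  -- If all three fail, `b * X` and `d * Y` both lie between `0.48` and `0.53`, while `d * X` and `b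
  -- * Y`, with sum 1 and the same product, differ by less than `0.28`. Then `(b + d) * |X - Y| <
  -- 0.33`, a contradiction.
  have h1 : 2304 / 10000 < (b * X) * (d * Y) := by nlinarith
  have h2 : (b * X) * (d * Y) ≤ 1 / 4 := by
    rw [← e]; nlinarith [sq_nonneg (d * X - b * Y)]
  have h3 : (d * X - b * Y) ^ 2 < (28 / 100) ^ 2 := by
    have : (d * X - b * Y) ^ 2 = (d * X + b * Y) ^ 2 - 4 * ((d * X) * (b * Y)) := by ring
    rw [this, h, e]; linarith
  have h4 := abs_lt_of_sq_lt_sq h3 (by norm_num)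
  have hu' : b * X < 53 / 100 := by nlinarith
  have hv' : d * Y < 53 / 100 := by nlinarith
  have h5 : (b + d) * |X - Y| = |(b * X - d * Y) + (d * X - b * Y)| := by
    have h6 : |(b + d) * (X - Y)| = (b + d) * |X - Y| := by
      rw [abs_mul, abs_of_pos (show 0 < b + d by linarith)]
    rw [← h6]
    congr 1; ring
  rw [h5] at hw
  rw [abs_lt] at h4
  rcases abs_cases ((b * X - d * Y) + (d * X - b * Y)) with h | h <;> linarith [h4.1, h4.2]

theorem exists_good_denominator {α : ℝ} {Q B : ℕ} (hQ : 1 ≤ Q) (hB : 2 * B ≤ Q)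
    (h : ∀ n : ℕ, 1 ≤ n → n ≤ B → ∀ m : ℤ, 2 / (Q : ℝ) < |n * α - m|) :
    ∃ (q : ℕ) (p : ℤ), B < q ∧ q ≤ 2 * Q ∧ IsCoprime p (q : ℤ) ∧ q * |q * α - p| ≤ 48 / 100 := by
  obtain ⟨a, c, b, d, hb1, hb, hd1, hd, hbd, hdet, h1, h2⟩ := exists_farey_neighbours α Q hQ
  have hb' : (1 : ℝ) ≤ b := by exact_mod_cast hb1
  have hd' : (1 : ℝ) ≤ d := by exact_mod_cast hd1
  have hQ' : (1 : ℝ) ≤ Q := by exact_mod_cast hQ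
  have hdet' : (b * c - a * d : ℝ) = 1 := by exact_mod_cast hdet
  have hX : 0 ≤ b * α - a := by linarith
  have hY : 0 ≤ c - d * α := by linarith
  have hXY : d * (b * α - a) + b * (c - d * α) = 1 := by linear_combination hdet'
  -- If `m ≤ B ≤ Q / 2`, the other denominator `n` exceeds `Q / 2`, so `|m * α - k| ≤ 1 / n < 2 /
  -- Q`, which `h` excludes.
  have small : ∀ (m n : ℕ) (t : ℝ) (k : ℤ), 1 ≤ m → Q < m + n → n * |m * α - k| ≤ 1 → B < m := by
    intro m n t k hm hmn ht
    by_contra! hle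
    have h3 := h m hm hle k
    have h4 : (Q : ℝ) ≤ 2 * n := by exact_mod_cast (by omega : Q ≤ 2 * n)
    rw [div_lt_iff₀ (by linarith)] at h3
    nlinarith [abs_nonneg (m * α - k)]
  have hBb : B < b := small b d 0 a hb1 hbd (by
    rw [abs_of_nonneg hX]; nlinarith)
  have hBd : B < d := small d b 0 c hd1 (by omega) (by
    rw [abs_sub_comm, abs_of_nonneg hY]; nlinarith)
  rcases hurwitz_trichotomy (by linarith : (0 : ℝ) < b) (by linarith : (0 : ℝ) < d) hXY with
    h3 | h3 | h3
  · exact ⟨b, a, hBb, by omega, ⟨-d, c, by linarith⟩, by rwa [abs_of_nonneg hX]⟩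
  · exact ⟨d, c, hBd, by omega, ⟨b, -a, by linarith⟩, by rwa [abs_sub_comm, abs_of_nonneg hY]⟩
  · refine ⟨b + d, a + c, by omega, by omega, ⟨b, -a, ?_⟩, ?_⟩
    · push_cast; linarith
    · push_cast
      convert h3 using 3
      ring

/-! ### Denominators on sparse scales for almost every rotation -/

theorem measure_norm_nsmul_le (n : ℕ) (hn : 1 ≤ n) (η : ℝ) :
    volume {y : UnitAddCircle | ‖n • y‖ ≤ η} ≤ ENNReal.ofReal (2 * η) := by
  have hp : MeasurePreserving (fun y : UnitAddCircle => n • y) volume volume := by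
    rcases hn.eq_or_lt with rfl | hn
    · simp only [one_nsmul]
      exact MeasurePreserving.id volume
    · exact (AddCircle.ergodic_nsmul hn).toMeasurePreserving
  have e : {y : UnitAddCircle | ‖n • y‖ ≤ η} = (fun y => n • y) ⁻¹' Metric.closedBall 0 η := by
    ext y; simp
  rw [e, hp.measure_preimage measurableSet_closedBall.nullMeasurableSet, AddCircle.volume_closedBall]
  exact ENNReal.ofReal_le_ofReal (min_le_right _ _)

/-- The number of binary digits of `k + 1`. -/
def digitCount (k : ℕ) : ℕ := Nat.log 2 (k + 1) + 1

/-- Upper ends of the denominator scales. -/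
def scaleTop (k : ℕ) : ℕ := 2 ^ (6 * (k + 1) * digitCount k)

/-- Lower ends of the denominator scales. -/
def scaleBot (k : ℕ) : ℕ := 2 ^ (6 * (k + 1) * digitCount k - 2 * digitCount k)

theorem succ_lt_two_pow_digitCount (k : ℕ) : k + 1 < 2 ^ digitCount k :=
  Nat.lt_pow_succ_log_self (by norm_num) _

theorem digitCount_pos (k : ℕ) : 1 ≤ digitCount k := by simp [digitCount]

theorem digitCount_le (k : ℕ) : digitCount k ≤ k + 1 := Nat.log_lt_self 2 (by simp)

theorem digitCount_mono {j k : ℕ} (h : j ≤ k) : digitCount j ≤ digitCount k := by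
  unfold digitCount
  have := Nat.log_mono_right (b := 2) (show j + 1 ≤ k + 1 by omega)
  omega

theorem scaleBot_mul (k : ℕ) : scaleBot k * 2 ^ (2 * digitCount k) = scaleTop k := by
  rw [scaleBot, scaleTop, ← pow_add]
  congr 1
  have : 2 * digitCount k ≤ 6 * (k + 1) * digitCount k := by nlinarith [digitCount_pos k]
  omega

/-- The exponent gains at least `6 * digitCount k` from one scale to the next; `2 * digitCount k`
pays for the width of the scale, the rest for the polynomial gap that separates combs. -/
theorem scaleTop_mul_le {j k : ℕ} (h : j < k) : scaleTop j * (j + 2) ^ 4 ≤ scaleBot k := by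
  have h1 : (j + 2) ^ 4 ≤ 2 ^ (4 * digitCount k) := by
    rw [mul_comm, pow_mul]
    exact Nat.pow_le_pow_left (by have := succ_lt_two_pow_digitCount k; omega) 4
  calc _ ≤ scaleTop j * 2 ^ (4 * digitCount k) := Nat.mul_le_mul_left _ h1
    _ ≤ _ := by
      rw [scaleTop, scaleBot, ← pow_add]
      apply Nat.pow_le_pow_right (by norm_num)
      have h2 := digitCount_mono h.le
      have h3 : 6 * (j + 1) * digitCount j ≤ 6 * (j + 1) * digitCount k :=
        Nat.mul_le_mul_left _ h2
      have h4 : 6 * (j + 2) * digitCount k ≤ 6 * (k + 1) * digitCount k :=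
        Nat.mul_le_mul_right _ (by omega)
      have h5 : 6 * (j + 2) * digitCount k = 6 * (j + 1) * digitCount k + 6 * digitCount k := by ring
      omega

/-- Borel–Cantelli: the exceptional set on scale `k` has measure at most `4 * scaleBot k / scaleTop
k`, and the factor `2 ^ (2 * digitCount k)` between the scale ends makes this at most `4 / (k + 1) ^
2`. -/
theorem ae_eventually_far :
    ∀ᵐ y : UnitAddCircle, ∀ᶠ k in atTop, ∀ n : ℕ, 1 ≤ n → n ≤ scaleBot k →
      2 / (scaleTop k : ℝ) < ‖n • y‖ := by
  set s : ℕ → Set UnitAddCircle := fun k =>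
    ⋃ n ∈ Finset.Icc 1 (scaleBot k), {y : UnitAddCircle | ‖n • y‖ ≤ 2 / (scaleTop k : ℝ)} with hs
  have hle : ∀ k, volume (s k) ≤ ENNReal.ofReal (4 * (1 / ((k : ℝ) + 1) ^ 2)) := by
    intro k
    have hT : (0 : ℝ) < scaleTop k := by unfold scaleTop; positivity
    calc _ ≤ ∑ n ∈ Finset.Icc 1 (scaleBot k),
            volume {y : UnitAddCircle | ‖n • y‖ ≤ 2 / (scaleTop k : ℝ)} :=
          measure_biUnion_finset_le _ _
      _ ≤ ∑ n ∈ Finset.Icc 1 (scaleBot k), ENNReal.ofReal (2 * (2 / (scaleTop k : ℝ))) :=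
          sum_le_sum fun n hn => measure_norm_nsmul_le n (Finset.mem_Icc.1 hn).1 _
      _ = ENNReal.ofReal (scaleBot k * (2 * (2 / (scaleTop k : ℝ)))) := by
          rw [Finset.sum_const, nsmul_eq_mul, ENNReal.ofReal_mul (Nat.cast_nonneg _),
            ENNReal.ofReal_natCast, Nat.card_Icc, Nat.add_sub_cancel]
      _ ≤ _ := by
          apply ENNReal.ofReal_le_ofReal
          have h1 : (scaleBot k : ℝ) * (2 ^ digitCount k) ^ 2 = scaleTop k := by
            rw [← pow_mul, mul_comm (digitCount k)]
            exact_mod_cast scaleBot_mul k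
          have h2 : ((k : ℝ) + 1) ≤ 2 ^ digitCount k := by
            exact_mod_cast (succ_lt_two_pow_digitCount k).le
          have h3 : ((k : ℝ) + 1) ^ 2 ≤ (2 ^ digitCount k) ^ 2 := by gcongr
          rw [show (scaleBot k : ℝ) * (2 * (2 / scaleTop k)) = 4 * (scaleBot k / scaleTop k) by ring]
          have h4 : (scaleBot k / scaleTop k : ℝ) ≤ 1 / ((k : ℝ) + 1) ^ 2 := by
            rw [div_le_div_iff₀ hT (by positivity), one_mul, ← h1]
            gcongr
          linarith
  have hsum : ∑' k, volume (s k) ≠ ⊤ := by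
    refine ne_top_of_le_ne_top ?_ (ENNReal.tsum_le_tsum hle)
    have : Summable fun k : ℕ => 4 * (1 / ((k : ℝ) + 1) ^ 2) := by
      apply Summable.mul_left
      have := (summable_nat_add_iff 1).2 (Real.summable_one_div_nat_pow.2 (by norm_num : 1 < 2))
      simpa using this
    rw [← ENNReal.ofReal_tsum_of_nonneg (fun k => by positivity) this]
    exact ENNReal.ofReal_ne_top
  filter_upwards [ae_eventually_notMem hsum] with y hy
  filter_upwards [hy] with k hk n hn1 hn2
  by_contra! hle
  exact hk (Set.mem_biUnion (Finset.mem_coe.2 (Finset.mem_Icc.2 ⟨hn1, hn2⟩)) hle)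

/-- Good rational approximations on every large scale. -/
theorem ae_exists_good_denominators :
    ∀ᵐ y : UnitAddCircle, ∀ᶠ k in atTop, ∃ (q : ℕ) (p : ℤ), scaleBot k < q ∧
      q ≤ 2 * scaleTop k ∧ IsCoprime p (q : ℤ) ∧ q * |q * circleRep y - p| ≤ 48 / 100 := by
  filter_upwards [ae_eventually_far] with y hy
  filter_upwards [hy] with k hk
  refine exists_good_denominator (Nat.one_le_two_pow) ?_ fun n hn1 hn2 m => ?_
  · rw [← scaleBot_mul, mul_comm]
    apply Nat.mul_le_mul_left
    calc 2 = 2 ^ 1 := rfl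
      _ ≤ _ := Nat.pow_le_pow_right (by norm_num) (by have := digitCount_pos k; omega)
  · refine (hk n hn1 hn2).trans_le ?_
    have : n • y = ((n * circleRep y : ℝ) : UnitAddCircle) := by
      rw [← nsmul_eq_mul, AddCircle.coe_nsmul, coe_circleRep]
    rw [this, UnitAddCircle.norm_eq]
    exact round_le _ _

theorem harmonic_le_of_le_scaleTop {q k : ℕ} (hq : 1 ≤ q) (h : q ≤ 2 * scaleTop k) :
    (harmonic q : ℝ) ≤ 8 * ((k + 1) * digitCount k) := by
  have h1 : (q : ℝ) ≤ 2 ^ (6 * (k + 1) * digitCount k + 1) := by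
    have : q ≤ 2 ^ (6 * (k + 1) * digitCount k + 1) := by rw [pow_succ']; exact h
    exact_mod_cast this
  have h2 := Real.log_le_log (by exact_mod_cast hq) h1
  rw [Real.log_pow] at h2
  have h3 : Real.log 2 ≤ 1 := by linarith [Real.log_two_lt_d9]
  have h4 := mul_le_mul_of_nonneg_left h3
    (show (0 : ℝ) ≤ ((6 * (k + 1) * digitCount k + 1 : ℕ) : ℝ) by positivity)
  have h5 := harmonic_le_one_add_log q
  have h6 : (1 : ℝ) ≤ (k + 1) * digitCount k := by
    exact_mod_cast Nat.mul_le_mul (show 1 ≤ k + 1 by omega) (digitCount_pos k)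
  push_cast at h4
  push_cast at h2
  linarith

/-- Cauchy condensation turns this into the harmonic series. It is the divergence that compensates
for the vanishing mass of the combs. -/
theorem not_summable_scale :
    ¬ Summable fun k : ℕ => 1 / (((k : ℝ) + 1) * digitCount k) := by
  set f : ℕ → ℝ := fun n => 1 / ((n : ℝ) * (Nat.log 2 n + 1 : ℕ)) with hf
  have h1 : ¬ Summable f := by
    rw [← summable_condensed_iff_of_nonneg (fun n => by positivity)]
    · have : (fun k : ℕ => (2 : ℝ) ^ k * f (2 ^ k)) = fun k : ℕ => 1 / (((k + 1 : ℕ) : ℝ)) := by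
        ext k
        simp only [hf, Nat.log_pow (by norm_num : 1 < 2)]
        push_cast
        field_simp
      rw [this, summable_nat_add_iff (f := fun k : ℕ => 1 / (k : ℝ)) 1]
      exact Real.not_summable_one_div_natCast
    · intro m n hm hmn
      have : (0 : ℝ) < m := by exact_mod_cast hm
      simp only [hf]
      gcongr
  intro h
  apply h1
  rw [← summable_nat_add_iff 1]
  simpa [hf, digitCount] using h

theorem le_scaleBot (k : ℕ) : k ≤ scaleBot k := by
  cases k with
  | zero => simp
  | succ j =>
    calc j + 1 ≤ 1 * (j + 2) ^ 1 := by rw [pow_one]; omega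
      _ ≤ scaleTop j * (j + 2) ^ 4 :=
        Nat.mul_le_mul Nat.one_le_two_pow (Nat.pow_le_pow_right (by omega) (by norm_num))
      _ ≤ _ := scaleTop_mul_le (Nat.lt_succ_self j)

theorem harmonic_le_quadratic {q k : ℕ} (hq : 1 ≤ q) (h : q ≤ 2 * scaleTop k) :
    (harmonic q : ℝ) ≤ 8 * ((k : ℝ) + 1) ^ 2 := by
  have h1 := harmonic_le_of_le_scaleTop hq h
  have h2 : (digitCount k : ℝ) ≤ k + 1 := by exact_mod_cast digitCount_le k
  have h3 : (0 : ℝ) ≤ k := k.cast_nonneg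
  nlinarith

theorem exists_finset_one_le_sum {f : ℕ → ℝ} (h0 : ∀ k, 0 ≤ f k) (h : ¬ Summable f) (k₀ : ℕ) :
    ∃ F : Finset ℕ, (∀ k ∈ F, k₀ ≤ k) ∧ 1 ≤ ∑ k ∈ F, f k := by
  rw [← summable_nat_add_iff k₀, not_summable_iff_tendsto_nat_atTop_of_nonneg fun n => h0 _] at h
  obtain ⟨n, hn⟩ := (h.eventually_ge_atTop 1).exists
  refine ⟨(range n).map (addRightEmbedding k₀), fun k hk => ?_, ?_⟩
  · obtain ⟨i, -, rfl⟩ := Finset.mem_map.1 hk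
    simp
  · rw [Finset.sum_map]
    exact hn

/-! ### Return times with Birkhoff sums near a given value -/

/-- For almost every rotation number, functions which match up to `δ` along the return times at
which the Birkhoff sums are close to `r` are `3 * δ`-close in mean. -/
theorem ae_integral_abs_sub_le : ∀ᵐ α : UnitAddCircle, ∀ (r ε δ K : ℝ) (a b : UnitAddCircle → ℝ),
    0 < ε → 0 ≤ δ → Measurable a → Measurable b → (∀ y, |a y| ≤ K) → (∀ y, |b y| ≤ K) →
    (∀ (q : ℕ) (y : UnitAddCircle), |∑ j ∈ range q, logCocycle (y + j • α) - r| ≤ ε →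
      |b (y + q • α) - a y| ≤ δ) → ∫ y, |b y - a y| ≤ 3 * δ := by
  -- The null set depends only on the approximation properties of `α`, so `r`, `ε` and the functions
  -- may be quantified inside.
  filter_upwards [ae_exists_good_denominators] with α hα r ε δ K a b hε hδ ha hb haK hbK hab
  have hlog : Tendsto (fun k : ℕ => Real.log ((k : ℝ))) atTop atTop :=
    Real.tendsto_log_atTop.comp tendsto_natCast_atTop_atTop
  obtain ⟨k₀, hk₀⟩ := eventually_atTop.1 (hα.and ((hlog.eventually_ge_atTop
    (100 * (|r| + ε + 2))).and ((tendsto_natCast_atTop_atTop (R := ℝ)).eventually_ge_atTop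
    (1600 / ε))))
  have hk : ∀ i : ℕ, ∃ (q : ℕ) (p : ℤ), scaleBot (i + k₀) < q ∧ q ≤ 2 * scaleTop (i + k₀) ∧
      IsCoprime p (q : ℤ) ∧ q * |q * circleRep α - p| ≤ 48 / 100 := fun i =>
    (hk₀ (i + k₀) (Nat.le_add_left _ _)).1
  choose q p hqB hqT hqp hqα using hk
  have hq1 : ∀ i, 1 ≤ q i := fun i => by have := hqB i; omega
  have hqr : ∀ i, (1 : ℝ) ≤ q i := fun i => by exact_mod_cast hq1 i
  have hqk : ∀ i, i + k₀ ≤ q i := fun i => (le_scaleBot _).trans (hqB i).le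
  have hH : ∀ i, 100 * (|r| + ε + 2) ≤ harmonic (q i) := fun i => by
    refine (hk₀ (i + k₀) (Nat.le_add_left _ _)).2.1.trans (le_trans ?_ (log_add_one_le_harmonic _))
    rcases Nat.eq_zero_or_pos (i + k₀) with h0 | h0
    · rw [h0]; simp only [Nat.cast_zero, Real.log_zero]
      exact Real.log_nonneg (by push_cast; linarith [hqr i])
    · apply Real.log_le_log (by exact_mod_cast h0)
      exact_mod_cast (hqk i).trans (Nat.le_succ _)
  have hHpos : ∀ i, (0 : ℝ) < harmonic (q i) := fun i => by linarith [hH i, abs_nonneg r]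
  have hE : ∀ i, ∃ E : Set UnitAddCircle, IsComb (q i) (ε / (100 * harmonic (q i) * q i)) E ∧
      ∀ y ∈ E, |∑ j ∈ range (q i), logCocycle (y + j • α) - r| ≤ ε := by
    intro i
    have hq0 : (0 : ℝ) < q i := by linarith [hqr i]
    have := exists_comb (hq1 i) (hqp i) (θ := q i * (q i * circleRep α - p i))
      (α := circleRep α) (r := r) hε (by rw [abs_mul, abs_of_pos hq0]; exact hqα i)
      (by field_simp; ring) (hH i)
    simpa only [coe_circleRep] using this
  choose E hEc hEr using hE
  have hmass : ∀ i, (q i : ℝ) * (ε / (100 * harmonic (q i) * q i)) = ε / (100 * harmonic (q i)) := by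
    intro i
    have h1 := hHpos i
    have h2 := hqr i
    field_simp
  have hseq : CombSequence q (fun i => ε / (100 * harmonic (q i) * q i)) E := by
    refine ⟨hEc, hq1, fun i => ?_, fun j k hjk => ?_⟩
    · have := hHpos i
      positivity
    · have hpos := hHpos j
      rw [hmass, div_mul_eq_mul_div, le_div_iff₀ (by positivity)]
      have e1 : (q j : ℝ) ≤ 2 * scaleTop (j + k₀) := by exact_mod_cast hqT j
      have e2 := harmonic_le_quadratic (hq1 j) (hqT j)
      have e3 : (scaleTop (j + k₀) : ℝ) * ((j + k₀ : ℕ) + 2) ^ 4 ≤ q k := by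
        have := (scaleTop_mul_le (show j + k₀ < k + k₀ by omega)).trans (hqB k).le
        exact_mod_cast this
      have e4 := (hk₀ (j + k₀) (Nat.le_add_left _ _)).2.2
      rw [div_le_iff₀ hε] at e4
      set J : ℝ := ((j + k₀ : ℕ) : ℝ) with hJ
      have hJ0 : 0 ≤ J := Nat.cast_nonneg _
      set T : ℝ := (scaleTop (j + k₀) : ℝ) with hT
      have hT0 : 0 ≤ T := Nat.cast_nonneg _
      have e5 : 1600 ≤ ε * (J + 2) ^ 2 := by nlinarith
      -- Of the four powers of `J + 2`, two absorb the harmonic bound and two the constant `1600 /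
      -- ε`.
      calc (q j : ℝ) * (100 * harmonic (q j)) ≤ (2 * T) * (100 * (8 * (J + 1) ^ 2)) := by gcongr
        _ = 1600 * (T * (J + 1) ^ 2) := by ring
        _ ≤ (ε * (J + 2) ^ 2) * (T * (J + 2) ^ 2) := by gcongr; norm_num
        _ = ε * (T * (J + 2) ^ 4) := by ring
        _ ≤ ε * q k := by gcongr
  have hqTop : Tendsto q atTop atTop :=
    tendsto_atTop_mono (fun i => (Nat.le_add_right i k₀).trans (hqk i)) tendsto_id
  have hβ : Tendsto (fun i => q i • α) atTop (𝓝 0) := by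
    rw [tendsto_zero_iff_norm_tendsto_zero]
    have h1 : Tendsto (fun i => 1 / (q i : ℝ)) atTop (𝓝 0) := by
      simp_rw [one_div]
      exact tendsto_inv_atTop_zero.comp (tendsto_natCast_atTop_atTop.comp hqTop)
    refine squeeze_zero (fun i => norm_nonneg _) (fun i => ?_) h1
    have : q i • α = ((q i * circleRep α : ℝ) : UnitAddCircle) := by
      rw [← nsmul_eq_mul, AddCircle.coe_nsmul, coe_circleRep]
    rw [this, UnitAddCircle.norm_eq, le_div_iff₀ (by linarith [hqr i])]
    have h2 := hqα i
    have h3 := round_le (q i * circleRep α) (p i)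
    have h4 := hqr i
    nlinarith
  refine hseq.integral_abs_sub_le ?_ hqTop hβ ha hb haK hbK
    (fun i y hy => hab (q i) y (hEr i y hy)) hδ
  intro i₀
  apply exists_finset_one_le_sum (f := fun k => (q k : ℝ) * (ε / (100 * harmonic (q k) * q k)))
  · intro k
    have := hHpos k
    positivity
  · intro hs
    apply not_summable_scale
    rw [← summable_nat_add_iff k₀]
    refine Summable.of_nonneg_of_le (fun i => by positivity) (fun i => ?_) (hs.mul_left (800 / ε))
    rw [hmass]
    have h1 := harmonic_le_of_le_scaleTop (hq1 i) (hqT i)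
    have h2 := hHpos i
    have h3 : 800 / ε * (ε / (100 * harmonic (q i))) = 8 / harmonic (q i) := by
      field_simp; norm_num
    have h4 : (0 : ℝ) < (((i + k₀ : ℕ) : ℝ) + 1) * digitCount (i + k₀) := by
      have : (0 : ℝ) < digitCount (i + k₀) := by exact_mod_cast digitCount_pos _
      positivity
    rw [h3, div_le_div_iff₀ h4 h2, one_mul]
    exact h1

/-! ### Sections of an invariant set and ergodicity -/

theorem birkhoff_mem_iff {α : UnitAddCircle} {A : Set (UnitAddCircle × ℝ)}
    (hA : cylindricalTransformation α logCocycle ⁻¹' A = A) (q : ℕ) (x : UnitAddCircle) (y : ℝ) :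
    (x + q • α, ∑ j ∈ range q, logCocycle (x + j • α) + y) ∈ A ↔ (x, y) ∈ A := by
  induction q with
  | zero => simp
  | succ q ih =>
    rw [← ih, sum_range_succ]
    conv_rhs => rw [← hA]
    rw [Set.mem_preimage, cylindricalTransformation, succ_nsmul, ← add_assoc, add_comm _ (logCocycle _),
      add_assoc (logCocycle _)]

theorem volume_shift_le (X : Set ℝ) (a b c : ℝ) :
    volume (X ∩ Ioo (a + c) (b + c)) ≤ volume (X ∩ Ioo a b) + ENNReal.ofReal (2 * |c|) := by
  have hsub : X ∩ Ioo (a + c) (b + c) ⊆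
      (X ∩ Ioo a b) ∪ (Icc (a - |c|) a ∪ Icc b (b + |c|)) := by
    rintro t ⟨ht, h1, h2⟩
    have h3 := neg_abs_le c
    have h4 := le_abs_self c
    rcases le_or_gt t a with h | h
    · exact Or.inr (Or.inl ⟨by linarith, h⟩)
    · rcases le_or_gt b t with h' | h'
      · exact Or.inr (Or.inr ⟨h', by linarith⟩)
      · exact Or.inl ⟨ht, h, h'⟩
  refine (measure_mono hsub).trans ((measure_union_le _ _).trans (add_le_add le_rfl ?_))
  refine (measure_union_le _ _).trans ?_
  rw [Real.volume_Icc, Real.volume_Icc, ← ENNReal.ofReal_add (by simp) (by simp)]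
  apply le_of_eq
  congr 1
  ring

theorem volume_inter_Ioo_ne_top (X : Set ℝ) (a b : ℝ) : volume (X ∩ Ioo a b) ≠ ⊤ :=
  ne_top_of_le_ne_top (by simp) (measure_mono Set.inter_subset_right)

theorem real_shift_le (X : Set ℝ) (a b c : ℝ) :
    |volume.real (X ∩ Ioo (a + c) (b + c)) - volume.real (X ∩ Ioo a b)| ≤ 2 * |c| := by
  have key : ∀ a b c : ℝ,
      volume.real (X ∩ Ioo (a + c) (b + c)) ≤ volume.real (X ∩ Ioo a b) + 2 * |c| := by
    intro a b c
    have h := ENNReal.toReal_mono (ENNReal.add_ne_top.2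
      ⟨volume_inter_Ioo_ne_top X a b, ENNReal.ofReal_ne_top⟩) (volume_shift_le X a b c)
    rwa [ENNReal.toReal_add (volume_inter_Ioo_ne_top _ _ _) ENNReal.ofReal_ne_top,
      ENNReal.toReal_ofReal (by positivity)] at h
  have h1 := key a b c
  have h2 := key (a + c) (b + c) (-c)
  rw [add_neg_cancel_right, add_neg_cancel_right, abs_neg] at h2
  rw [abs_le]
  constructor <;> linarith

theorem measurable_section_volume {A : Set (UnitAddCircle × ℝ)} (hA : MeasurableSet A) (a b : ℝ) :
    Measurable fun x => volume.real ((Prod.mk x ⁻¹' A) ∩ Ioo a b) := by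
  have := measurable_measure_prodMk_left (ν := (volume : Measure ℝ))
    (hA.inter (MeasurableSet.univ.prod (measurableSet_Ioo (a := a) (b := b))))
  convert! this.ennreal_toReal using 1
  ext x
  rw [measureReal_def]
  congr 2
  ext t
  simp

theorem section_volume_le (X : Set ℝ) (a b : ℝ) : |volume.real (X ∩ Ioo a b)| ≤ |b - a| := by
  rw [abs_of_nonneg measureReal_nonneg]
  refine ENNReal.toReal_le_of_le_ofReal (abs_nonneg _) ?_
  calc _ ≤ volume (Ioo a b) := measure_mono Set.inter_subset_right
    _ = ENNReal.ofReal (b - a) := Real.volume_Ioo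
    _ ≤ _ := ENNReal.ofReal_le_ofReal (le_abs_self _)

theorem volume_add_preimage_inter (X : Set ℝ) (s a b : ℝ) :
    volume (((fun t => s + t) ⁻¹' X) ∩ Ioo a b) = volume (X ∩ Ioo (a + s) (b + s)) := by
  rw [← measure_preimage_add volume s (X ∩ _)]
  congr 1
  ext t
  simp only [Set.mem_inter_iff, Set.mem_preimage, Set.mem_Ioo]
  constructor <;> rintro ⟨h1, h2, h3⟩ <;> refine ⟨h1, ?_, ?_⟩ <;> linarith

/-- A set whose trace on intervals is invariant under rational translations is trivial. -/
theorem null_or_conull_of_shift_invariant {X : Set ℝ} (hX : MeasurableSet X)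
    (h : ∀ a b r : ℚ, volume.real (X ∩ Ioo (a + r : ℝ) (b + r)) = volume.real (X ∩ Ioo (a : ℝ) b)) :
    volume X = 0 ∨ volume Xᶜ = 0 := by
  have hreal : ∀ (a b : ℚ) (r : ℝ),
      volume.real (X ∩ Ioo (a + r : ℝ) (b + r)) = volume.real (X ∩ Ioo (a : ℝ) b) := by
    intro a b
    have hc : Continuous fun r : ℝ => volume.real (X ∩ Ioo (a + r : ℝ) (b + r)) := by
      refine (LipschitzWith.of_dist_le_mul (K := 2) fun r s => ?_).continuous
      have := real_shift_le X (a + s) (b + s) (r - s)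
      rw [Real.dist_eq, Real.dist_eq]
      rwa [add_assoc, add_assoc, add_sub_cancel] at this
    exact fun r => congrFun (Continuous.ext_on Rat.denseRange_cast hc continuous_const
      (by rintro _ ⟨r, rfl⟩; exact h a b r)) r
  -- Lebesgue measure restricted to `X` is translation invariant, hence a multiple `c` of Lebesgue
  -- measure. It vanishes on the complement of `X`, so `c = 0` or that complement is null.
  set ν := volume.restrict X with hν
  have hinv : ν.IsAddLeftInvariant := by
    refine ⟨fun s => (Real.measure_ext_Ioo_rat fun a b => Eq.symm ?_).symm⟩
    rw [Measure.map_apply (measurable_const_add s) measurableSet_Ioo,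
      Set.preimage_const_add_Ioo, hν, Measure.restrict_apply measurableSet_Ioo,
      Measure.restrict_apply measurableSet_Ioo, Set.inter_comm, Set.inter_comm (Ioo (a : ℝ) b)]
    have := hreal a b (-s)
    rw [measureReal_def, measureReal_def, ENNReal.toReal_eq_toReal_iff'
      (volume_inter_Ioo_ne_top _ _ _) (volume_inter_Ioo_ne_top _ _ _)] at this
    simpa only [sub_eq_add_neg] using this
  have hs := Measure.isAddLeftInvariant_eq_smul ν volume
  set c := ν.addHaarScalarFactor volume
  have h0 : ν Xᶜ = 0 := by
    rw [hν, Measure.restrict_apply hX.compl]; simp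
  rw [hs, Measure.smul_apply, smul_eq_zero] at h0
  rcases h0 with h0 | h0
  · left
    have : ν Set.univ = 0 := by rw [hs, h0]; simp
    simpa [hν] using this
  · exact Or.inr h0

theorem ae_addOrderOf_eq_zero : ∀ᵐ α : UnitAddCircle, addOrderOf α = 0 := by
  filter_upwards [ae_eventually_far] with α hα
  rw [addOrderOf_eq_zero_iff']
  intro n hn h0
  obtain ⟨k, hk, hkn⟩ := (hα.and (eventually_ge_atTop n)).exists
  have h1 := hk n hn (hkn.trans (le_scaleBot k))
  rw [h0, norm_zero] at h1
  have : 0 ≤ 2 / (scaleTop k : ℝ) := by positivity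
  linarith

theorem measurable_logCocycle : Measurable logCocycle :=
  measurable_const.sub (Real.measurable_log.comp (measurable_const.sub circleRep_measurable))

theorem measurePreserving_cylindricalTransformation (α : UnitAddCircle) :
    MeasurePreserving (cylindricalTransformation α logCocycle)
      ((volume : Measure UnitAddCircle).prod (volume : Measure ℝ))
      ((volume : Measure UnitAddCircle).prod (volume : Measure ℝ)) := by
  refine MeasurePreserving.skew_product (f := fun x : UnitAddCircle => x + α)
    (g := fun x y => logCocycle x + y) (measurePreserving_add_right volume α) ?_ ?_
  · exact (measurable_logCocycle.comp measurable_fst).add measurable_snd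
  · exact Eventually.of_forall fun x => (measurePreserving_add_left volume (logCocycle x)).map_eq

theorem propositionp3 :
    ∀ᵐ α : UnitAddCircle ∂(MeasureTheory.volume : MeasureTheory.Measure UnitAddCircle),
      Ergodic (cylindricalTransformation α logCocycle)
        ((MeasureTheory.volume : MeasureTheory.Measure UnitAddCircle).prod
          (MeasureTheory.volume : MeasureTheory.Measure ℝ)) := by
  filter_upwards [ae_integral_abs_sub_le, ae_addOrderOf_eq_zero] with α hα hα0
  refine ⟨measurePreserving_cylindricalTransformation α, ⟨fun A hAm hA => ?_⟩⟩
  have hsec : ∀ (q : ℕ) (x : UnitAddCircle), Prod.mk x ⁻¹' A =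
      (fun t => ∑ j ∈ range q, logCocycle (x + j • α) + t) ⁻¹' (Prod.mk (x + q • α) ⁻¹' A) := by
    intro q x
    ext t
    exact (birkhoff_mem_iff hA q x t).symm
  have hshift : ∀ a b r : ℚ, ∀ᵐ x : UnitAddCircle,
      volume.real ((Prod.mk x ⁻¹' A) ∩ Ioo (a + r : ℝ) (b + r)) =
        volume.real ((Prod.mk x ⁻¹' A) ∩ Ioo (a : ℝ) b) := by
    intro a b r
    set f : UnitAddCircle → ℝ := fun x => volume.real ((Prod.mk x ⁻¹' A) ∩ Ioo (a : ℝ) b)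
    set g : UnitAddCircle → ℝ := fun x =>
      volume.real ((Prod.mk x ⁻¹' A) ∩ Ioo (a + r : ℝ) (b + r))
    have hf : Measurable f := measurable_section_volume hAm _ _
    have hg : Measurable g := measurable_section_volume hAm _ _
    have hfK : ∀ x, |f x| ≤ |(b : ℝ) - a| := fun x => section_volume_le _ _ _
    have hgK : ∀ x, |g x| ≤ |(b : ℝ) - a| := fun x => by
      refine (section_volume_le _ _ _).trans (le_of_eq ?_)
      congr 1; ring
    have hle : ∀ ε : ℝ, 0 < ε → ∫ x, |g x - f x| ≤ 3 * (2 * ε) := by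
      intro ε hε
      -- The value `2 * ε` reflects that moving an interval by `c` changes its trace on a set by at
      -- most `2 * |c|`.
      refine hα r ε (2 * ε) _ f g hε (by positivity) hf hg hfK hgK fun q y hy => ?_
      set s := ∑ j ∈ range q, logCocycle (y + j • α)
      have e : f y = volume.real ((Prod.mk (y + q • α) ⁻¹' A) ∩ Ioo (a + s : ℝ) (b + s)) := by
        simp only [f]
        rw [hsec q y, measureReal_def, volume_add_preimage_inter, ← measureReal_def]
      rw [e]
      have := real_shift_le (Prod.mk (y + q • α) ⁻¹' A) (a + s) (b + s) (r - s)
      rw [abs_sub_comm (r : ℝ)] at this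
      have e1 : (a + s + (r - s) : ℝ) = a + r := by ring
      have e2 : (b + s + (r - s) : ℝ) = b + r := by ring
      rw [e1, e2] at this
      linarith
    have hi : Integrable (fun x => |g x - f x|) :=
      ((integrable_of_bounded hg hgK).sub (integrable_of_bounded hf hfK)).abs
    have h0 : ∫ x, |g x - f x| = 0 := by
      refine le_antisymm (le_of_forall_pos_le_add fun ε hε => ?_)
        (integral_nonneg fun x => abs_nonneg _)
      have := hle (ε / 6) (by positivity)
      linarith
    rw [integral_eq_zero_iff_of_nonneg (fun x => abs_nonneg _) hi] at h0
    filter_upwards [h0] with x hx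
    exact sub_eq_zero.1 (abs_eq_zero.1 hx)
  have htriv : ∀ᵐ x : UnitAddCircle,
      volume (Prod.mk x ⁻¹' A) = 0 ∨ volume (Prod.mk x ⁻¹' A)ᶜ = 0 := by
    have := ae_all_iff.2 fun a => ae_all_iff.2 fun b => ae_all_iff.2 fun r => hshift a b r
    filter_upwards [this] with x hx
    exact null_or_conull_of_shift_invariant (measurable_prodMk_left hAm) hx
  have hmeas : MeasurableSet {x : UnitAddCircle | volume (Prod.mk x ⁻¹' A) = 0} :=
    (measurable_measure_prodMk_left (ν := (volume : Measure ℝ)) hAm) (measurableSet_singleton 0)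
  -- Sections over `x` and `x + α` are translates of each other, so nullity is constant along the
  -- rotation.
  have hinv : (fun x => x + α) ⁻¹' {x : UnitAddCircle | volume (Prod.mk x ⁻¹' A) = 0} =
      {x : UnitAddCircle | volume (Prod.mk x ⁻¹' A) = 0} := by
    ext x
    have := hsec 1 x
    rw [one_nsmul] at this
    simp only [Set.mem_preimage, Set.mem_ofPred_eq]
    rw [this, measure_preimage_add]
  rw [eventuallyConst_set]
  rcases eventuallyConst_set.1
    ((AddCircle.ergodic_add_right.2 hα0).aeconst_set hmeas hinv) with h | h
  · right
    have h0 := (Measure.measure_prod_null (μ := (volume : Measure UnitAddCircle))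
      (ν := (volume : Measure ℝ)) hAm).2 h
    exact measure_eq_zero_iff_ae_notMem.1 h0
  · left
    have h0 := (Measure.measure_prod_null (μ := (volume : Measure UnitAddCircle))
      (ν := (volume : Measure ℝ)) hAm.compl).2 (by
        filter_upwards [h, htriv] with x hx hx'
        exact hx'.resolve_left hx)
    filter_upwards [measure_eq_zero_iff_ae_notMem.1 h0] with p hp
    exact not_not.1 hp
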